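/- Graphs are finite and may have loops and parallel edges. A \emph{plane graph} is a graph together with a topological embedding in the plane, given by the cyclic order (rotation) of the edge-ends around each vertex; a loop has two ends at its vertex. A graph is \emph{4-regular} if exactly four edge-ends are attached to each vertex. A \emph{circuit} of length $k\ge 1$ is a closed walk $(e_0,e_1,\dots,e_{k-1})$ with pairwise distinct edges, where $e_i$ is traversed from $u_i$ to $u_{i+1}$ and indices are taken modulo $k$; circuits that differ only in the starting edge or in the direction of traversal are identified. A \emph{circuit partition} of $G$ is a set of circuits such that every edge of $G$ lies in exactly one of them. In a 4-regular plane graph, a \emph{thread} with midpoint $\beta$ is an unordered pair of distinct edge-ends at $\beta$ that are not contiguous in the cyclic order around $\beta$; so every vertex is the midpoint of exactly two threads. A circuit is \emph{threaded} if, for each $i$ modulo $k$, the end at which it arrives along $e_{i-1}$ at $u_i$ and the end at which it leaves along $e_i$ form a thread $p_i$; a circuit partition is \emph{threaded} if all its circuits are. An \emph{under-over assignment} $\upsilon$ assigns a value in $\{-1,+1\}$ to each thread. It is \emph{consistent} if the two threads with midpoint $\beta$ get opposite values, for every vertex $\beta$, and it is \emph{alternating} for a threaded circuit partition $C$ if $\upsilon(p_i)=-\upsilon(p_{i+1})$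 for each circuit in $C$ and each $i$ modulo its length $k$. \textbf{Theorem.} Every 4-regular plane graph $G$ has a unique threaded circuit partition, and this threaded circuit partition has a consistent alternating under-over assignment. Further, this threaded circuit partition can be found in linear time: there is a program for a unit-cost random access machine which, given the rotation system of any 4-regular plane graph with $n$ vertices and $m$ edges, lists the circuits of its threaded circuit partition in $O(n+m+1)$ steps, using only numbers of size $O(n+m+1)$. -/

import Mathlib

universe u v

/-- The two ends (half-edges) of an edge `e` are `(e, false)` and `(e, true)`; a loop also has two
ends.  A half-edge `h` also stands for its edge traversed away from that end. -/
abbrev HalfEdge (E : Type v) : Type v := E × Bool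

/-- The other end of the same edge. -/
def HalfEdge.flip {E : Type v} (h : HalfEdge E) : HalfEdge E := (h.1, !h.2)

/-- A multigraph (loops and parallel edges allowed) with vertex set `V` and edge set `E`, embedded
in an oriented surface.  The embedding is given combinatorially: `rot h` is the half-edge that
follows `h` in the counterclockwise cyclic order of the half-edges around the vertex `vert h`. -/
structure EmbeddedGraph (V : Type u) (E : Type v) where
  /-- the vertex at which a half-edge is attached -/
  vert : HalfEdge E → V
  /-- the rotation system -/
  rot : Equiv.Perm (HalfEdge E)
  /-- the half-edges at one vertex form one cycle of the rotation -/
  vert_eq_iff : ∀ h h' : HalfEdge E, vert h = vert h' ↔ rot.SameCycle h h'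

namespace EmbeddedGraph

variable {V : Type u} {E : Type v}

/-- Connected components of the graph. -/
def Component (G : EmbeddedGraph V E) : Type u :=
  Quot fun u v : V => ∃ e : E, G.vert (e, false) = u ∧ G.vert (e, true) = v

/-- Facial walks: traverse an edge, then continue with the next half-edge in the rotation at the
vertex that has been reached. -/
def FacialWalk (G : EmbeddedGraph V E) : Type v :=
  Quot fun h h' : HalfEdge E => h' = G.rot h.flip

/-- Vertices without edges; each is a component with one face and no facial walk. -/
def IsolatedVertex (G : EmbeddedGraph V E) : Type u :=
  {v : V // ∀ h : HalfEdge E, G.vert h ≠ v}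

/-- A finite embedded graph is plane if Euler's formula `v - e + f = 2 c` holds, where `c` is the
number of components and the faces are counted for each component by itself.  As `v - e + f ≤ 2`
for a connected graph, this says that every component is embedded in the sphere. -/
def IsPlane (G : EmbeddedGraph V E) : Prop :=
  Nat.card V + (Nat.card G.FacialWalk + Nat.card G.IsolatedVertex) =
    Nat.card E + 2 * Nat.card G.Component

/-- Every vertex has degree four; a loop contributes two to the degree. -/
def IsFourRegular (G : EmbeddedGraph V E) : Prop :=
  ∀ v : V, Nat.card {h : HalfEdge E // G.vert h = v} = 4

/-- Two different half-edges at one vertex that are not contiguous in the cyclic order. -/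
def IsThread (G : EmbeddedGraph V E) (a b : HalfEdge E) : Prop :=
  G.vert a = G.vert b ∧ a ≠ b ∧ G.rot a ≠ b ∧ G.rot b ≠ a

/-- A thread, as an unordered pair of half-edges meeting at its midpoint. -/
def Thread (G : EmbeddedGraph V E) : Type v :=
  {p : Sym2 (HalfEdge E) // ∃ a b, G.IsThread a b ∧ p = s(a, b)}

/-- The thread formed by two half-edges. -/
def IsThread.thread {G : EmbeddedGraph V E} {a b : HalfEdge E} (h : G.IsThread a b) : G.Thread :=
  ⟨s(a, b), a, b, h, rfl⟩

/-- A circuit `(e_0, …, e_{k-1})`, `k ≥ 1`, with a starting edge and a direction: `darts` lists the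
traversed edges, each represented by the half-edge at which its traversal starts. -/
structure Circuit (G : EmbeddedGraph V E) where
  darts : List (HalfEdge E)
  ne_nil : darts ≠ []
  /-- the edges are distinct -/
  edges_nodup : (darts.map Prod.fst).Nodup
  /-- every edge, including the last one, ends where the (cyclically) next one starts -/
  closed : ∀ i : Fin darts.length, G.vert (darts.get i).flip =
    G.vert (darts[(i.val + 1) % darts.length]'(Nat.mod_lt _ i.pos))

namespace Circuit

variable {G : EmbeddedGraph V E}

/-- The `i`-th directed edge; indices are taken modulo the length of the circuit. -/
def dart (c : G.Circuit) (i : ℕ) : HalfEdge E :=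
  c.darts[i % c.darts.length]'(Nat.mod_lt _ (List.length_pos_of_ne_nil c.ne_nil))

/-- A circuit is threaded if any two cyclically consecutive edges form a thread at the vertex
where the circuit passes from the one to the other. -/
def IsThreaded (c : G.Circuit) : Prop :=
  ∀ i : ℕ, G.IsThread (c.dart i).flip (c.dart (i + 1))

/-- Two lists describe the same circuit if they differ by the choice of the starting edge and of
the direction of traversal. -/
def Same (c c' : G.Circuit) : Prop :=
  c.darts ~r c'.darts ∨ (c.darts.map HalfEdge.flip).reverse ~r c'.darts

theorem same_equivalence : Equivalence (Same (G := G)) := by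
  have ff : ∀ l : List (HalfEdge E),
      (((l.map HalfEdge.flip).reverse).map HalfEdge.flip).reverse = l := by
    intro l
    have : (HalfEdge.flip ∘ HalfEdge.flip : HalfEdge E → HalfEdge E) = id := by
      funext h; simp [HalfEdge.flip]
    simp [List.map_reverse, this]
  have cong : ∀ {l l' : List (HalfEdge E)}, l ~r l' →
      (l.map HalfEdge.flip).reverse ~r (l'.map HalfEdge.flip).reverse :=
    fun h => (h.map _).reverse
  refine ⟨fun c => Or.inl (List.IsRotated.refl _), ?_, ?_⟩
  · rintro c c' (h | h)
    · exact Or.inl h.symm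
    · refine Or.inr ?_
      have := cong h
      rw [ff] at this
      exact this.symm
  · rintro c c' c'' (h | h) (h' | h')
    · exact Or.inl (h.trans h')
    · exact Or.inr ((cong h).trans h')
    · exact Or.inr (h.trans h')
    · refine Or.inl ?_
      have := cong h
      rw [ff] at this
      exact this.trans h'

instance setoid (G : EmbeddedGraph V E) : Setoid G.Circuit := ⟨Same, same_equivalence⟩

end Circuit

/-- Circuits without a distinguished starting edge and direction. -/
def FreeCircuit (G : EmbeddedGraph V E) : Type v := Quotient (Circuit.setoid G)

/-- Forget the starting edge and the direction of a circuit. -/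
def Circuit.free {G : EmbeddedGraph V E} (c : G.Circuit) : G.FreeCircuit := Quotient.mk _ c

/-- A set of circuits such that every edge is in exactly one of them. -/
def IsCircuitPartition (G : EmbeddedGraph V E) (P : Set G.FreeCircuit) : Prop :=
  ∀ e : E, ∃! γ : G.FreeCircuit, γ ∈ P ∧ ∃ c : G.Circuit, c.free = γ ∧ e ∈ c.darts.map Prod.fst

/-- A circuit partition all of whose circuits are threaded. -/
def IsThreadedCircuitPartition (G : EmbeddedGraph V E) (P : Set G.FreeCircuit) : Prop :=
  G.IsCircuitPartition P ∧ ∀ c : G.Circuit, c.free ∈ P → c.IsThreaded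

/-- An under-over assignment gives `-1` or `+1` to every thread. -/
abbrev UnderOver (G : EmbeddedGraph V E) : Type v := G.Thread → ℤˣ

/-- Different threads with the same midpoint get opposite values. -/
def UnderOver.Consistent {G : EmbeddedGraph V E} (υ : G.UnderOver) : Prop :=
  ∀ (a b a' b' : HalfEdge E) (h : G.IsThread a b) (h' : G.IsThread a' b'),
    G.vert a = G.vert a' → h.thread ≠ h'.thread → υ h.thread = -υ h'.thread

/-- Cyclically consecutive threads of the circuit get opposite values. -/
def UnderOver.AlternatingOn {G : EmbeddedGraph V E} (υ : G.UnderOver) (c : G.Circuit)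
    (hc : c.IsThreaded) : Prop :=
  ∀ i : ℕ, υ (hc i).thread = -υ (hc (i + 1)).thread

/-- Alternating on every circuit of a threaded circuit partition. -/
def UnderOver.Alternating {G : EmbeddedGraph V E} (υ : G.UnderOver) {P : Set G.FreeCircuit}
    (hP : G.IsThreadedCircuitPartition P) : Prop :=
  ∀ (c : G.Circuit) (hc : c.free ∈ P), υ.AlternatingOn c (hP.2 c hc)

end EmbeddedGraph

/-! A random access machine with unit cost, programmed by while-programs. -/

namespace RAM

/-- Registers `reg 0, reg 1, …`, and a memory that is addressed through registers.  A program
mentions only finitely many registers. -/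
structure State where
  reg : ℕ → ℕ
  mem : ℕ → ℕ

/-- Programs. -/
inductive Program : Type
  /-- do nothing -/
  | skip
  /-- `reg d := k` -/
  | const (d k : ℕ)
  /-- `reg d := reg a` -/
  | copy (d a : ℕ)
  /-- `reg d := reg a + reg b` -/
  | add (d a b : ℕ)
  /-- `reg d := reg a - reg b`, or `0` if this is negative -/
  | sub (d a b : ℕ)
  /-- `reg d := mem (reg a)` -/
  | load (d a : ℕ)
  /-- `mem (reg a) := reg b` -/
  | store (a b : ℕ)
  /-- first `p`, then `q` -/
  | seq (p q : Program)
  /-- if `reg a < reg b` then `p` else `q` -/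
  | ifLt (a b : ℕ) (p q : Program)
  /-- while `reg a < reg b` do `p` -/
  | whileLt (a b : ℕ) (p : Program)

/-- Assign a value to a register. -/
def State.setReg (s : State) (d x : ℕ) : State := ⟨Function.update s.reg d x, s.mem⟩

/-- Write a value to a memory cell. -/
def State.setMem (s : State) (a x : ℕ) : State := ⟨s.reg, Function.update s.mem a x⟩

/-- `Exec B p s s' t`: started in state `s`, the program `p` halts in state `s'` after `t` steps,
and all numbers that it computes are at most `B` (there is no rule for an overflow).  Every
elementary instruction and every evaluation of a test costs one step. -/
inductive Exec (B : ℕ) : Program → State → State → ℕ → Prop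
  | skip (s : State) : Exec B .skip s s 1
  | const (s : State) (d k : ℕ) (h : k ≤ B) : Exec B (.const d k) s (s.setReg d k) 1
  | copy (s : State) (d a : ℕ) : Exec B (.copy d a) s (s.setReg d (s.reg a)) 1
  | add (s : State) (d a b : ℕ) (h : s.reg a + s.reg b ≤ B) :
      Exec B (.add d a b) s (s.setReg d (s.reg a + s.reg b)) 1
  | sub (s : State) (d a b : ℕ) : Exec B (.sub d a b) s (s.setReg d (s.reg a - s.reg b)) 1
  | load (s : State) (d a : ℕ) : Exec B (.load d a) s (s.setReg d (s.mem (s.reg a))) 1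
  | store (s : State) (a b : ℕ) : Exec B (.store a b) s (s.setMem (s.reg a) (s.reg b)) 1
  | seq {p q : Program} {s s' s'' : State} {t t' : ℕ} (h : Exec B p s s' t)
      (h' : Exec B q s' s'' t') : Exec B (.seq p q) s s'' (t + t')
  | ifTrue {p : Program} {s s' : State} {t a b : ℕ} (q : Program) (hab : s.reg a < s.reg b)
      (h : Exec B p s s' t) : Exec B (.ifLt a b p q) s s' (t + 1)
  | ifFalse {q : Program} {s s' : State} {t a b : ℕ} (p : Program) (hab : ¬ s.reg a < s.reg b)
      (h : Exec B q s s' t) : Exec B (.ifLt a b p q) s s' (t + 1)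
  | whileTrue {p : Program} {s s' s'' : State} {t t' a b : ℕ} (hab : s.reg a < s.reg b)
      (h : Exec B p s s' t) (h' : Exec B (.whileLt a b p) s' s'' t') :
      Exec B (.whileLt a b p) s s'' (t + t' + 1)
  | whileFalse {s : State} {a b : ℕ} (p : Program) (hab : ¬ s.reg a < s.reg b) :
      Exec B (.whileLt a b p) s s 1

/-- The initial state: the input is in the memory from address `0` on, all else is zero. -/
def initial (input : List ℕ) : State := ⟨fun _ => 0, fun a => input.getD a 0⟩

/-- The final state presents a list of numbers: it is in the memory from address `reg 0` on. -/
def Presents (s : State) (output : List ℕ) : Prop :=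
  ∀ i : Fin output.length, s.mem (s.reg 0 + i) = output.get i

end RAM

namespace EmbeddedGraph

/-- The half-edges of a graph with edges `0, …, m-1` in the order of their codes. -/
def halfEdges (m : ℕ) : List (HalfEdge (Fin m)) :=
  (List.finRange m).map (fun e => (e, false)) ++ (List.finRange m).map (fun e => (e, true))

/-- The code of a half-edge: `e` for `(e, false)`, and `m + e` for `(e, true)`. -/
def code {m : ℕ} (h : HalfEdge (Fin m)) : ℕ := if h.2 then m + h.1 else h.1

/-- An embedded graph as input: the numbers of vertices and of edges, then for each half-edge the
next half-edge in the rotation, then for each half-edge its vertex. -/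
def input {n m : ℕ} (G : EmbeddedGraph (Fin n) (Fin m)) : List ℕ :=
  n :: m :: ((halfEdges m).map (fun h => code (G.rot h)) ++
    (halfEdges m).map (fun h => (G.vert h : ℕ)))

/-- A list of circuits as output: the number of circuits, then for each circuit its length and its
edges, in order and with their directions. -/
def output {n m : ℕ} {G : EmbeddedGraph (Fin n) (Fin m)} (L : List G.Circuit) : List ℕ :=
  L.length :: L.flatMap (fun c => c.darts.length :: c.darts.map code)

/-- The program finds a threaded circuit partition of every plane 4-regular graph in linear time:
with `n` vertices and `m` edges it takes at most `C * (n + m + 1)` steps on numbers of at most this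
size, and lists each circuit of the partition exactly once. -/
def FindsThreadedCircuitPartitionInLinearTime (p : RAM.Program) : Prop :=
  ∃ C : ℕ, ∀ (n m : ℕ) (G : EmbeddedGraph (Fin n) (Fin m)), G.IsPlane → G.IsFourRegular →
    ∃ (s : RAM.State) (t : ℕ) (L : List G.Circuit),
      RAM.Exec (C * (n + m + 1)) p (RAM.initial G.input) s t ∧
      t ≤ C * (n + m + 1) ∧
      RAM.Presents s (output L) ∧
      (L.map Circuit.free).Nodup ∧
      G.IsThreadedCircuitPartition {γ | γ ∈ L.map Circuit.free}

end EmbeddedGraph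

/-!
In a 4-regular graph a half-edge `h` forms a thread with `rot (rot h)` only, so that a threaded
circuit that traverses an edge must go on with `next h = rot (rot h.flip)`. Hence the threaded
circuits are the orbits of the permutation `next`. As `next (next h).flip = h.flip`, reversal maps
orbits to orbits; no orbit is mapped to itself, since otherwise some half-edge would be fixed by
`flip` or sent to its reversal by `next`. So an orbit traverses no edge twice, and every edge lies
in just one threaded circuit.

Signs of half-edges that change under `flip` and under `rot` give an under-over assignment that is
both consistent and alternating. In the plane they come from a colouring of the faces with two
colours such that the two sides of each edge differ: face boundaries are orthogonal to coboundaries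
over `ZMod 2`, by Euler's formula they span the orthogonal complement, and as all degrees are even
this complement contains the sum of all edges.

A program finds the circuits greedily: from each edge not yet traversed it follows `next` until it
returns. The time is linear because every step of this kind marks a new edge.
-/

section Cycles

variable {α : Type*}

theorem cycle_chain_map_range_iff {r : α → α → Prop} {g : ℕ → α} {n : ℕ} (hn : 0 < n)
    (hg : Function.Periodic g n) :
    Cycle.Chain r ((List.range n).map g : List α) ↔ ∀ i, r (g i) (g (i + 1)) := by
  obtain ⟨k, rfl⟩ := Nat.exists_eq_add_one_of_ne_zero hn.ne'
  rw [← Cycle.map_coe, Cycle.chain_map, Cycle.chain_range_succ]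
  have hclose : g (k + 1) = g 0 := by simpa only [zero_add] using hg 0
  refine ⟨fun ⟨hlast, hinit⟩ i => ?_, fun h => ⟨hclose ▸ h k, fun i _ => h i⟩⟩
  have hper : Function.Periodic (fun i => r (g i) (g (i + 1))) (k + 1) := fun i => by
    simp only [hg i, add_right_comm i (k + 1) 1, hg (i + 1)]
  refine (hper.map_mod_nat i).mp ?_
  rcases Nat.lt_succ_iff_lt_or_eq.1 (Nat.mod_lt i hn) with hi | hi
  · exact hinit _ hi
  · simpa only [hi, hclose] using hlast

theorem cycle_chain_reverse_iff {r : α → α → Prop} {s : Cycle α} :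
    s.reverse.Chain r ↔ s.Chain fun a b => r b a := by
  induction s using Quotient.inductionOn with | h l => ?_
  rcases l with - | ⟨a, l⟩
  · rfl
  · have hrev : (a :: (l ++ [a])).reverse = a :: (l.reverse ++ [a]) := by simp
    change Cycle.Chain r ((a :: l : List α) : Cycle α).reverse ↔ _
    rw [Cycle.reverse_coe, List.reverse_cons, ← Cycle.coe_cons_eq_coe_append,
      Cycle.chain_coe_cons, ← hrev, List.isChain_reverse]
    rfl

theorem exists_eq_cons_of_mem_cycle {s : Cycle α} {x : α} (hx : x ∈ s) :
    ∃ l : List α, s = (x :: l : List α) := by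
  induction s using Quotient.inductionOn with | h l => ?_
  obtain ⟨l₁, l₂, rfl⟩ := List.append_of_mem (Cycle.mem_coe_iff.1 hx)
  exact ⟨l₂ ++ l₁, Cycle.coe_eq_coe.2 List.isRotated_append⟩

end Cycles

section Iterates

variable {α : Type*} {f σ : α → α} {x : α}

theorem iterate_eq_self_iff_eq_minimalPeriod {i : ℕ} (hi₀ : 0 < i)
    (hi : i ≤ Function.minimalPeriod f x) : f^[i] x = x ↔ i = Function.minimalPeriod f x :=
  ⟨fun h => hi.antisymm (Function.IsPeriodicPt.minimalPeriod_le hi₀ h),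
    fun h => h ▸ Function.iterate_minimalPeriod⟩

theorem minimalPeriod_eq_of_nodup_iterates {n : ℕ} (hn : 0 < n) (hx : f^[n] x = x)
    (hnodup : ((List.range n).map fun i => f^[i] x).Nodup) : Function.minimalPeriod f x = n := by
  have hper : Function.IsPeriodicPt f n x := hx
  refine (hper.minimalPeriod_le hn).antisymm (not_lt.1 fun hlt => ?_)
  have hinj := List.inj_on_of_nodup_map hnodup (List.mem_range.2 hlt) (List.mem_range.2 hn)
    Function.iterate_minimalPeriod
  exact (hper.minimalPeriod_pos hn).ne' hinj

theorem cycle_eq_periodicOrbit {s : Cycle α} (hs : s.Nodup) (hchain : s.Chain fun a b => f a = b)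
    (hx : x ∈ s) : s = Function.periodicOrbit f x := by
  obtain ⟨l, rfl⟩ := exists_eq_cons_of_mem_cycle hx
  have hiter : ∀ i (hi : i < (x :: (l ++ [x])).length), f^[i] x = (x :: (l ++ [x]))[i] :=
    ((Cycle.chain_coe_cons _ _ _).1 hchain).iterate_eq_of_apply_eq
  have hlist : x :: l = (List.range (l.length + 1)).map fun i => f^[i] x :=
    List.ext_getElem (by simp) fun i hi _ => by
      rw [List.getElem_map, List.getElem_range, hiter i (hi.trans_le (by simp))]
      exact (List.getElem_append_left (as := x :: l) hi).symm
  have hx : f^[l.length + 1] x = x := by simp [hiter]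
  rw [hlist, Cycle.nodup_coe_iff] at hs
  rw [hlist, Function.periodicOrbit_def,
    minimalPeriod_eq_of_nodup_iterates l.length.succ_pos hx hs]

theorem minimalPeriod_perm_eq_card [Finite α] (π : Equiv.Perm α) (x : α) :
    Function.minimalPeriod π x = Nat.card {y // π.SameCycle x y} := by
  classical
  have hx : x ∈ Function.periodicPts π := π.injective.mem_periodicPts x
  have hmem : ∀ y, y ∈ (Function.periodicOrbit π x).toFinset ↔ π.SameCycle x y := fun y => by
    rw [Function.periodicOrbit_def, Cycle.coe_toFinset, List.mem_toFinset, ← Cycle.mem_coe_iff,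
      ← Function.periodicOrbit_def, Function.mem_periodicOrbit_iff hx]
    exact ⟨fun ⟨i, hi⟩ => ⟨i, by simpa only [zpow_natCast, ← Equiv.Perm.iterate_eq_pow]⟩,
      fun h => h.exists_nat_pow_eq.imp fun i hi => by rwa [Equiv.Perm.iterate_eq_pow]⟩
  rw [Nat.subtype_card _ hmem, Function.periodicOrbit_def, Cycle.coe_toFinset,
    List.toFinset_card_of_nodup, List.length_map, List.length_range]
  simpa only [Function.periodicOrbit_def, Cycle.nodup_coe_iff] using
    (Function.nodup_periodicOrbit (f := π) (x := x))

theorem iterate_reversal_iterate (hσ : ∀ x, f (σ (f x)) = σ x) (i : ℕ) (x : α) :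
    f^[i] (σ (f^[i] x)) = σ x := by
  induction i generalizing x with
  | zero => rfl
  | succ i ih => rw [Function.iterate_succ_apply, Function.iterate_succ_apply' f i, hσ, ih]

theorem iterate_ne_reversal (hf : f.Injective) (hσ : ∀ x, f (σ (f x)) = σ x)
    (h0 : ∀ x, x ≠ σ x) (h1 : ∀ x, f x ≠ σ x) (k : ℕ) (x : α) : f^[k] x ≠ σ x := by
  induction k using Nat.twoStepInduction generalizing x with
  | zero => exact h0 x
  | one => exact h1 x
  | more k ih _ =>
    intro h
    rw [Function.iterate_succ_apply', Function.iterate_succ_apply, ← hσ] at h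
    exact ih _ (hf h)

theorem iterate_ne_reversal_iterate (hf : f.Injective) (hσ : ∀ x, f (σ (f x)) = σ x)
    (h0 : ∀ x, x ≠ σ x) (h1 : ∀ x, f x ≠ σ x) (i j : ℕ) (x : α) :
    f^[i] x ≠ σ (f^[j] x) := fun h => by
  have := congrArg f^[j] h
  rw [iterate_reversal_iterate hσ, ← Function.iterate_add_apply] at this
  exact iterate_ne_reversal hf hσ h0 h1 _ _ this

end Iterates

namespace HalfEdge

variable {E : Type*}

@[simp] theorem flip_flip (h : HalfEdge E) : h.flip.flip = h := by
  simp only [flip, Bool.not_not]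

theorem ne_flip (h : HalfEdge E) : h ≠ h.flip := fun H => by
  simpa [flip] using congrArg Prod.snd H

theorem flip_injective : Function.Injective (flip : HalfEdge E → HalfEdge E) :=
  Function.LeftInverse.injective flip_flip

theorem eq_or_eq_flip {h h' : HalfEdge E} (H : h.1 = h'.1) : h = h' ∨ h = h'.flip := by
  obtain ⟨e, b⟩ := h
  obtain ⟨e', b'⟩ := h'
  obtain rfl : e = e' := H
  cases b <;> cases b' <;> simp [flip]

end HalfEdge

namespace EmbeddedGraph

section Threads

variable {V : Type*} {E : Type*} {G : EmbeddedGraph V E}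

theorem vert_rot (G : EmbeddedGraph V E) (h : HalfEdge E) : G.vert (G.rot h) = G.vert h :=
  (G.vert_eq_iff _ _).2 (Equiv.Perm.sameCycle_apply_left.2 (Equiv.Perm.SameCycle.refl _ _))

theorem IsThread.symm {a b : HalfEdge E} (h : G.IsThread a b) : G.IsThread b a :=
  ⟨h.1.symm, h.2.1.symm, h.2.2.2, h.2.2.1⟩

theorem isThread_comm {a b : HalfEdge E} : G.IsThread a b ↔ G.IsThread b a :=
  ⟨IsThread.symm, IsThread.symm⟩

theorem minimalPeriod_rot [Finite E] (G : EmbeddedGraph V E) (h : HalfEdge E) :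
    Function.minimalPeriod G.rot h = Nat.card {h' : HalfEdge E // G.vert h' = G.vert h} := by
  simp only [minimalPeriod_perm_eq_card, ← G.vert_eq_iff, eq_comm]

namespace IsFourRegular

variable [Finite E]

theorem iterate_rot_eq_iff (hG : G.IsFourRegular) (h : HalfEdge E) {i j : ℕ} :
    G.rot^[i] h = G.rot^[j] h ↔ i % 4 = j % 4 := by
  have hper : Function.minimalPeriod G.rot h = 4 := (G.minimalPeriod_rot h).trans (hG _)
  have hmod : ∀ i, G.rot^[i % 4] h = G.rot^[i] h := fun i => by
    rw [← hper, Function.iterate_mod_minimalPeriod_eq]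
  rw [← hmod i, ← hmod j]
  apply Function.iterate_eq_iterate_iff_of_lt_minimalPeriod <;> rw [hper] <;>
    exact Nat.mod_lt _ four_pos

theorem exists_iterate_rot_eq (hG : G.IsFourRegular) {a b : HalfEdge E}
    (hab : G.vert a = G.vert b) : ∃ i < 4, G.rot^[i] a = b := by
  obtain ⟨i, hi⟩ := ((G.vert_eq_iff _ _).1 hab).exists_nat_pow_eq
  refine ⟨i % 4, Nat.mod_lt _ four_pos, ?_⟩
  rw [← hi, ← Equiv.Perm.iterate_eq_pow, hG.iterate_rot_eq_iff, Nat.mod_mod]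

theorem rot_four (hG : G.IsFourRegular) (h : HalfEdge E) :
    G.rot (G.rot (G.rot (G.rot h))) = h :=
  (hG.iterate_rot_eq_iff h (i := 4) (j := 0)).2 rfl

theorem isThread_iff (hG : G.IsFourRegular) {a b : HalfEdge E} :
    G.IsThread a b ↔ b = G.rot (G.rot a) := by
  constructor
  · rintro ⟨hv, hne, hab, hba⟩
    obtain ⟨i, hi, rfl⟩ := hG.exists_iterate_rot_eq hv
    interval_cases i
    · exact absurd rfl hne
    · exact absurd rfl hab
    · rfl
    · exact absurd (hG.rot_four a) hba
  · rintro rfl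
    have hrot := fun i j => hG.iterate_rot_eq_iff a (i := i) (j := j)
    exact ⟨by rw [vert_rot, vert_rot], fun H => absurd ((hrot 0 2).1 H) (by decide),
      fun H => absurd ((hrot 1 2).1 H) (by decide), fun H => absurd ((hrot 3 0).1 H) (by decide)⟩

end IsFourRegular

end Threads

end EmbeddedGraph

namespace EmbeddedGraph

section ThreadedCircuits

variable {V : Type*} {E : Type*} {G : EmbeddedGraph V E}

namespace Circuit

/-- The directed edges of a circuit up to the choice of the starting edge. -/
def cycle (c : G.Circuit) : Cycle (HalfEdge E) := c.darts

theorem nodup_cycle (c : G.Circuit) : c.cycle.Nodup := .of_map _ c.edges_nodup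

theorem length_darts_pos (c : G.Circuit) : 0 < c.darts.length :=
  List.length_pos_of_ne_nil c.ne_nil

theorem map_range_dart (c : G.Circuit) : (List.range c.darts.length).map c.dart = c.darts :=
  List.ext_getElem (by simp only [List.length_map, List.length_range]) fun i _ hi => by
    simp only [List.getElem_map, List.getElem_range, dart, Nat.mod_eq_of_lt hi]

theorem dart_mod (c : G.Circuit) (i : ℕ) : c.dart (i % c.darts.length) = c.dart i := by
  simp only [dart, Nat.mod_mod]

theorem periodic_dart (c : G.Circuit) : Function.Periodic c.dart c.darts.length := fun i => by
  rw [← c.dart_mod, Nat.add_mod_right, c.dart_mod]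

theorem isThreaded_iff_chain {c : G.Circuit} :
    c.IsThreaded ↔ c.cycle.Chain fun a b => G.IsThread a.flip b := by
  rw [cycle, ← c.map_range_dart, cycle_chain_map_range_iff c.length_darts_pos c.periodic_dart]
  rfl

theorem isThreaded_iff_chain_reverse {c : G.Circuit} :
    c.IsThreaded ↔ (c.cycle.map HalfEdge.flip).reverse.Chain fun a b => G.IsThread a.flip b := by
  simp only [isThreaded_iff_chain, cycle_chain_reverse_iff, Cycle.chain_map, HalfEdge.flip_flip,
    isThread_comm]

theorem free_eq_iff {c c' : G.Circuit} :
    c.free = c'.free ↔ c.cycle = c'.cycle ∨ (c.cycle.map HalfEdge.flip).reverse = c'.cycle := by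
  rw [cycle, cycle, Cycle.map_coe, Cycle.reverse_coe, Cycle.coe_eq_coe, Cycle.coe_eq_coe]
  exact Quotient.eq (r := setoid G)

theorem isThreaded_of_free_eq {c c' : G.Circuit} (h : c.free = c'.free) (hc : c.IsThreaded) :
    c'.IsThreaded := by
  rw [isThreaded_iff_chain]
  rcases free_eq_iff.1 h with h | h
  · exact h ▸ isThreaded_iff_chain.1 hc
  · exact h ▸ isThreaded_iff_chain_reverse.1 hc

theorem mem_edges_iff_of_free_eq {c c' : G.Circuit} (h : c.free = c'.free) {e : E} :
    e ∈ c.darts.map Prod.fst ↔ e ∈ c'.darts.map Prod.fst := by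
  rw [List.mem_map, List.mem_map]
  change (∃ a, a ∈ c.cycle ∧ a.1 = e) ↔ ∃ a, a ∈ c'.cycle ∧ a.1 = e
  rcases free_eq_iff.1 h with h | h
  · rw [h]
  · simp only [← h, Cycle.mem_reverse_iff, Cycle.mem_map, exists_exists_and_eq_and,
      HalfEdge.flip]

end Circuit

/-- Traverse an edge, then leave the vertex that has been reached through the second half-edge in
the rotation; in a 4-regular graph this half-edge forms a thread with the one of the arrival. -/
def next (G : EmbeddedGraph V E) (h : HalfEdge E) : HalfEdge E := G.rot (G.rot h.flip)

theorem next_injective (G : EmbeddedGraph V E) : Function.Injective G.next :=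
  G.rot.injective.comp (G.rot.injective.comp HalfEdge.flip_injective)

/-- The first `i` half-edges that are met when one follows threads from `h` on. -/
def walk (G : EmbeddedGraph V E) (h : HalfEdge E) (i : ℕ) : List (HalfEdge E) :=
  (List.range i).map fun j => G.next^[j] h

@[simp] theorem length_walk (h : HalfEdge E) (i : ℕ) : (G.walk h i).length = i := by
  simp only [walk, List.length_map, List.length_range]

@[simp] theorem getElem_walk (h : HalfEdge E) {i j : ℕ} (hj : j < (G.walk h i).length) :
    (G.walk h i)[j] = G.next^[j] h := by
  simp only [walk, List.getElem_map, List.getElem_range]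

theorem walk_succ (h : HalfEdge E) (i : ℕ) :
    G.walk h (i + 1) = G.walk h i ++ [G.next^[i] h] := by
  simp only [walk, List.range_succ, List.map_append, List.map_cons, List.map_nil]

variable [Finite E]

theorem mem_periodicPts_next (h : HalfEdge E) : h ∈ Function.periodicPts G.next :=
  G.next_injective.mem_periodicPts h

theorem minimalPeriod_next_pos (h : HalfEdge E) : 0 < Function.minimalPeriod G.next h :=
  Function.minimalPeriod_pos_of_mem_periodicPts (mem_periodicPts_next h)

namespace IsFourRegular

theorem isThread_flip_iff (hG : G.IsFourRegular) {a b : HalfEdge E} :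
    G.IsThread a.flip b ↔ b = G.next a :=
  hG.isThread_iff

theorem next_flip_next (hG : G.IsFourRegular) (h : HalfEdge E) :
    G.next (G.next h).flip = h.flip := by
  rw [next, HalfEdge.flip_flip, next, hG.rot_four]

theorem next_ne_flip (hG : G.IsFourRegular) (h : HalfEdge E) : G.next h ≠ h.flip :=
  (hG.isThread_flip_iff.2 rfl).2.1.symm

theorem iterate_next_fst_eq_iff (hG : G.IsFourRegular) {i j : ℕ} {h : HalfEdge E} :
    (G.next^[i] h).1 = (G.next^[j] h).1 ↔ G.next^[i] h = G.next^[j] h :=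
  ⟨fun H => (HalfEdge.eq_or_eq_flip H).resolve_right <|
    iterate_ne_reversal_iterate G.next_injective hG.next_flip_next HalfEdge.ne_flip
      hG.next_ne_flip i j h, congrArg Prod.fst⟩

theorem nodup_edges_walk (hG : G.IsFourRegular) {h : HalfEdge E} {i : ℕ}
    (hi : i ≤ Function.minimalPeriod G.next h) : ((G.walk h i).map Prod.fst).Nodup := by
  rw [walk, List.map_map, List.nodup_map_iff_inj_on List.nodup_range]
  intro j hj k hk hjk
  exact (Function.iterate_eq_iterate_iff_of_lt_minimalPeriod
    ((List.mem_range.1 hj).trans_le hi) ((List.mem_range.1 hk).trans_le hi)).1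
    (hG.iterate_next_fst_eq_iff.1 hjk)

/-- The threaded circuit that starts with a given half-edge. -/
noncomputable def circuit (hG : G.IsFourRegular) (h : HalfEdge E) : G.Circuit where
  darts := G.walk h (Function.minimalPeriod G.next h)
  ne_nil := List.ne_nil_of_length_pos (by simpa only [length_walk] using minimalPeriod_next_pos h)
  edges_nodup := hG.nodup_edges_walk le_rfl
  closed i := by
    simp only [List.get_eq_getElem, getElem_walk, length_walk,
      Function.iterate_mod_minimalPeriod_eq, Function.iterate_succ_apply', next, vert_rot]

theorem isThreaded_circuit (hG : G.IsFourRegular) (h : HalfEdge E) :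
    (hG.circuit h).IsThreaded := by
  rw [Circuit.isThreaded_iff_chain]
  refine (Function.periodicOrbit_chain' _ (mem_periodicPts_next h)).2 fun i => ?_
  rw [hG.isThread_flip_iff, Function.iterate_succ_apply']

theorem mem_cycle_circuit (hG : G.IsFourRegular) (h : HalfEdge E) : h ∈ (hG.circuit h).cycle :=
  Function.self_mem_periodicOrbit (mem_periodicPts_next h)

theorem cycle_eq_periodicOrbit (hG : G.IsFourRegular) {s : Cycle (HalfEdge E)} (hs : s.Nodup)
    (hthread : s.Chain fun a b => G.IsThread a.flip b) {h : HalfEdge E} (hh : h ∈ s) :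
    s = Function.periodicOrbit G.next h :=
  _root_.cycle_eq_periodicOrbit hs (hthread.imp fun _ _ h => (hG.isThread_flip_iff.1 h).symm) hh

theorem free_eq_of_common_edge (hG : G.IsFourRegular) {c c' : G.Circuit} (hc : c.IsThreaded)
    (hc' : c'.IsThreaded) {e : E} (he : e ∈ c.darts.map Prod.fst)
    (he' : e ∈ c'.darts.map Prod.fst) : c.free = c'.free := by
  obtain ⟨h, hh, rfl⟩ := List.mem_map.1 he
  obtain ⟨h', hh', heq⟩ := List.mem_map.1 he'
  have hcycle := hG.cycle_eq_periodicOrbit c'.nodup_cycle (Circuit.isThreaded_iff_chain.1 hc') hh'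
  rw [Circuit.free_eq_iff, hcycle]
  rcases HalfEdge.eq_or_eq_flip heq with rfl | rfl
  · exact .inl (hG.cycle_eq_periodicOrbit c.nodup_cycle (Circuit.isThreaded_iff_chain.1 hc) hh)
  · refine .inr (hG.cycle_eq_periodicOrbit ?_ (Circuit.isThreaded_iff_chain_reverse.1 hc) ?_)
    · rw [Cycle.nodup_reverse_iff]
      exact c.nodup_cycle.map HalfEdge.flip_injective
    · rw [Cycle.mem_reverse_iff]
      exact Cycle.mem_map.2 ⟨h, hh, rfl⟩

end IsFourRegular

variable (G) in
/-- The circuits of the unique threaded circuit partition: all threaded circuits. -/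
def threadedCircuits : Set G.FreeCircuit :=
  {γ | ∃ c : G.Circuit, c.IsThreaded ∧ c.free = γ}

namespace IsFourRegular

theorem isThreadedCircuitPartition (hG : G.IsFourRegular) :
    G.IsThreadedCircuitPartition G.threadedCircuits := by
  refine ⟨fun e => ?_, fun c ⟨c', hc', h⟩ => Circuit.isThreaded_of_free_eq h hc'⟩
  have hthread := hG.isThreaded_circuit (e, false)
  have he : e ∈ (hG.circuit (e, false)).darts.map Prod.fst :=
    List.mem_map.2 ⟨_, hG.mem_cycle_circuit (e, false), rfl⟩
  refine ⟨(hG.circuit (e, false)).free, ⟨⟨_, hthread, rfl⟩, _, rfl, he⟩, ?_⟩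
  rintro γ ⟨⟨c, hc, rfl⟩, c', hcc', he'⟩
  rw [← hcc']
  exact hG.free_eq_of_common_edge (Circuit.isThreaded_of_free_eq hcc'.symm hc) hthread he' he

theorem eq_threadedCircuits (hG : G.IsFourRegular) {P : Set G.FreeCircuit}
    (hP : ∀ c : G.Circuit, c.free ∈ P → c.IsThreaded)
    (hcover : ∀ e : E, ∃ c : G.Circuit, c.free ∈ P ∧ e ∈ c.darts.map Prod.fst) :
    P = G.threadedCircuits := by
  ext γ
  constructor
  · obtain ⟨c, rfl⟩ := Quotient.exists_rep γ
    exact fun hc => ⟨c, hP c hc, rfl⟩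
  · rintro ⟨c, hc, rfl⟩
    obtain ⟨h, hh⟩ := List.exists_mem_of_ne_nil _ c.ne_nil
    obtain ⟨c', hc', he⟩ := hcover h.1
    rwa [hG.free_eq_of_common_edge hc (hP c' hc') (List.mem_map_of_mem hh) he]

theorem existsUnique_isThreadedCircuitPartition (hG : G.IsFourRegular) :
    ∃! P : Set G.FreeCircuit, G.IsThreadedCircuitPartition P :=
  ⟨_, hG.isThreadedCircuitPartition, fun _ hP => hG.eq_threadedCircuits hP.2 fun e =>
    let ⟨_, ⟨hγ, c, hc, he⟩, _⟩ := hP.1 e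
    ⟨c, hc ▸ hγ, he⟩⟩

end IsFourRegular

end ThreadedCircuits

end EmbeddedGraph

section Duality

theorem nondegenerate_dotProductBilin (K ι : Type*) [Field K] [Fintype ι] :
    (dotProductBilin K K : LinearMap.BilinForm K (ι → K)).Nondegenerate := by
  classical
  refine LinearMap.BilinForm.nondegenerate_iff_ker_eq_bot.2 <| LinearMap.ker_eq_bot'.2 fun x hx =>
    dotProduct_eq_zero x fun y => LinearMap.congr_fun hx y

theorem finrank_le_card_of_le_range_funLeft {K X Y : Type*} [Field K] [Finite Y] {π : X → Y}
    {W : Submodule K (X → K)} (hW : W ≤ LinearMap.range (LinearMap.funLeft K K π)) :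
    Module.finrank K W ≤ Nat.card Y := by
  have := Fintype.ofFinite Y
  calc Module.finrank K W ≤ Module.finrank K (LinearMap.range (LinearMap.funLeft K K π)) :=
        Submodule.finrank_mono hW
    _ ≤ Module.finrank K (Y → K) := LinearMap.finrank_range_le _
    _ = Nat.card Y := by rw [Module.finrank_fintype_fun_eq_card, Nat.card_eq_fintype_card]

end Duality

namespace EmbeddedGraph

section Faces

variable {V : Type*} {E : Type*} {X : Type*} {G : EmbeddedGraph V E}

/-- The faces of an embedded graph, each component being embedded in a surface of its own: there is
a face for each facial walk, and one around each isolated vertex. -/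
abbrev Face (G : EmbeddedGraph V E) : Type _ := G.FacialWalk ⊕ G.IsolatedVertex

/-- The face whose facial walk traverses a half-edge. -/
def face (G : EmbeddedGraph V E) (h : HalfEdge E) : G.Face := .inl (Quot.mk _ h)

/-- The component that contains a vertex. -/
def component (G : EmbeddedGraph V E) (v : V) : G.Component := Quot.mk _ v

theorem face_rot_flip (G : EmbeddedGraph V E) (h : HalfEdge E) :
    G.face (G.rot h.flip) = G.face h :=
  congrArg Sum.inl (Quot.sound (r := fun h h' : HalfEdge E => h' = G.rot h.flip) rfl).symm

theorem component_vert_flip (G : EmbeddedGraph V E) (h : HalfEdge E) :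
    G.component (G.vert h.flip) = G.component (G.vert h) := by
  obtain ⟨e, _ | _⟩ := h
  · exact (Quot.sound ⟨e, rfl, rfl⟩).symm
  · exact Quot.sound ⟨e, rfl, rfl⟩

/-- The component that contains the boundary of a face. -/
def Face.component : G.Face → G.Component :=
  Sum.elim
    (Quot.lift (fun h => G.component (G.vert h)) fun h _ hh => by
      rw [hh, vert_rot, component_vert_flip])
    fun v => G.component v.1

theorem eq_of_vert_eq [Finite E] {x : HalfEdge E → X} (hx : ∀ h, x (G.rot h) = x h)
    {a b : HalfEdge E} (hab : G.vert a = G.vert b) : x a = x b := by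
  obtain ⟨i, rfl⟩ := ((G.vert_eq_iff _ _).1 hab).exists_nat_pow_eq
  have hsemi : Function.Semiconj x G.rot id := hx
  rw [← Equiv.Perm.iterate_eq_pow, (hsemi.iterate_right i).eq, Function.iterate_id, id]

/-- The sum modulo two of a function over the labels of the two ends of each edge. For
`φ = G.vert` this is the coboundary of a set of vertices, and for `φ = G.face` the boundary of a set
of faces. -/
def edgeSum (φ : HalfEdge E → X) : (X → ZMod 2) →ₗ[ZMod 2] (E → ZMod 2) where
  toFun g e := g (φ (e, false)) + g (φ (e, true))
  map_add' g g' := by ext e; exact add_add_add_comm _ _ _ _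
  map_smul' a g := by ext e; exact (mul_add _ _ _).symm

theorem edgeSum_apply_fst (φ : HalfEdge E → X) (g : X → ZMod 2) (h : HalfEdge E) :
    edgeSum φ g h.1 = g (φ h) + g (φ h.flip) := by
  obtain ⟨e, _ | _⟩ := h
  · rfl
  · exact add_comm _ _

theorem mem_ker_edgeSum {φ : HalfEdge E → X} {g : X → ZMod 2} :
    g ∈ LinearMap.ker (edgeSum φ) ↔ ∀ h, g (φ h.flip) = g (φ h) := by
  rw [LinearMap.mem_ker]
  refine ⟨fun hg h => ?_, fun hg => funext fun e => ?_⟩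
  · exact (CharTwo.add_eq_zero.1 ((edgeSum_apply_fst φ g h).symm.trans (congrFun hg h.1))).symm
  · exact CharTwo.add_eq_zero.2 (hg (e, true))

theorem finrank_ker_edgeSum_vert_le [Finite V] (G : EmbeddedGraph V E) :
    Module.finrank (ZMod 2) (LinearMap.ker (edgeSum G.vert)) ≤ Nat.card G.Component := by
  have : Finite G.Component := Quot.finite _
  refine finrank_le_card_of_le_range_funLeft (π := G.component) fun g hg => ?_
  refine ⟨Quot.lift g ?_, rfl⟩
  rintro _ _ ⟨e, rfl, rfl⟩
  exact mem_ker_edgeSum.1 hg (e, true)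

theorem finrank_ker_edgeSum_face_le [Finite V] [Finite E] (G : EmbeddedGraph V E) :
    Module.finrank (ZMod 2) (LinearMap.ker (edgeSum G.face)) ≤ Nat.card G.Component := by
  have : Finite G.Component := Quot.finite _
  refine finrank_le_card_of_le_range_funLeft (π := Face.component) fun f hf => ?_
  have hflip : ∀ h, f (G.face h.flip) = f (G.face h) := mem_ker_edgeSum.1 hf
  have hrot : ∀ h, f (G.face (G.rot h)) = f (G.face h) := fun h => by
    rw [← hflip h, ← face_rot_flip G h.flip, HalfEdge.flip_flip]
  let isolated : V → ZMod 2 := Function.extend Subtype.val (fun v => f (.inr v)) 0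
  let g : V → ZMod 2 := Function.extend G.vert (fun h => f (G.face h)) isolated
  have hvert : ∀ h, g (G.vert h) = f (G.face h) :=
    Function.FactorsThrough.extend_apply (fun _ _ => eq_of_vert_eq hrot) isolated
  have hisolated : ∀ v : G.IsolatedVertex, g v.1 = f (.inr v) := fun v =>
    (Function.extend_apply' _ _ _ fun ⟨h, hh⟩ => v.2 h hh).trans
      (Subtype.val_injective.extend_apply _ _ v)
  refine ⟨Quot.lift g ?_, funext ?_⟩
  · rintro _ _ ⟨e, rfl, rfl⟩
    rw [hvert, hvert]
    exact hflip (e, true)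
  · rintro (φ | v)
    · induction φ using Quot.ind with | mk h => exact hvert h
    · exact hisolated v

theorem sum_halfEdge [Fintype E] {M : Type*} [AddCommMonoid M] (x : HalfEdge E → M) :
    ∑ h, x h = ∑ e, (x (e, false) + x (e, true)) := by
  simp only [Fintype.sum_prod_type, Fintype.sum_bool, add_comm]

theorem edgeSum_face_dotProduct_edgeSum_vert [Fintype E] (f : G.Face → ZMod 2) (g : V → ZMod 2) :
    edgeSum G.face f ⬝ᵥ edgeSum G.vert g = 0 := by
  have hturn : ∑ h : HalfEdge E, f (G.face h) * g (G.vert h.flip) =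
      ∑ h : HalfEdge E, f (G.face h) * g (G.vert h) := by
    refine Fintype.sum_bijective (fun h : HalfEdge E => G.rot h.flip)
      (G.rot.bijective.comp (Function.Involutive.bijective HalfEdge.flip_flip)) _ _ fun h => ?_
    rw [face_rot_flip, vert_rot]
  calc edgeSum G.face f ⬝ᵥ edgeSum G.vert g
      = ∑ h : HalfEdge E, f (G.face h) * edgeSum G.vert g h.1 := by
        rw [sum_halfEdge]
        exact Finset.sum_congr rfl fun e _ => add_mul _ _ _
    _ = 0 := by
        simp_rw [edgeSum_apply_fst, mul_add, Finset.sum_add_distrib, hturn,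
          CharTwo.add_self_eq_zero]

theorem sum_edgeSum_vert_eq_zero [Finite V] [Fintype E]
    (hG : ∀ v, Even (Nat.card {h : HalfEdge E // G.vert h = v})) (g : V → ZMod 2) :
    ∑ e, edgeSum G.vert g e = 0 := by
  classical
  have := Fintype.ofFinite V
  calc ∑ e, edgeSum G.vert g e = ∑ h : HalfEdge E, g (G.vert h) :=
        (sum_halfEdge fun h => g (G.vert h)).symm
    _ = ∑ v, ∑ h : HalfEdge E with G.vert h = v, g v :=
        (Finset.sum_fiberwise' _ _ _).symm
    _ = 0 := Finset.sum_eq_zero fun v _ => by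
        rw [Finset.sum_const, ← Fintype.card_subtype, ← Nat.card_eq_fintype_card, nsmul_eq_mul,
          (ZMod.natCast_eq_zero_iff_even).2 (hG v), zero_mul]

/-- The faces of a plane graph generate its cycle space. -/
theorem IsPlane.range_edgeSum_face [Finite V] [Fintype E] (hG : G.IsPlane) :
    LinearMap.range (edgeSum G.face) = LinearMap.BilinForm.orthogonal
      (dotProductBilin (ZMod 2) (ZMod 2)) (LinearMap.range (edgeSum G.vert)) := by
  have : Finite G.FacialWalk := Quot.finite _
  have : Finite G.IsolatedVertex := inferInstanceAs (Finite (Subtype _))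
  have := Fintype.ofFinite V
  have := Fintype.ofFinite G.FacialWalk
  have := Fintype.ofFinite G.IsolatedVertex
  refine Submodule.eq_of_le_of_finrank_le ?_ ?_
  · rintro _ ⟨f, rfl⟩ _ ⟨g, rfl⟩
    exact (dotProduct_comm _ _).trans (edgeSum_face_dotProduct_edgeSum_vert f g)
  · rw [LinearMap.BilinForm.finrank_orthogonal (nondegenerate_dotProductBilin _ _)]
    have hvert := LinearMap.finrank_range_add_finrank_ker (edgeSum G.vert)
    have hface := LinearMap.finrank_range_add_finrank_ker (edgeSum G.face)
    have hvert_ker := G.finrank_ker_edgeSum_vert_le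
    have hface_ker := G.finrank_ker_edgeSum_face_le
    unfold IsPlane at hG
    rw [Module.finrank_fintype_fun_eq_card, ← Nat.card_eq_fintype_card] at hvert hface ⊢
    rw [Nat.card_sum] at hface
    omega

theorem IsPlane.exists_edgeSum_face_eq_one [Finite V] [Finite E] (hG : G.IsPlane)
    (heven : ∀ v, Even (Nat.card {h : HalfEdge E // G.vert h = v})) :
    ∃ f : G.Face → ZMod 2, edgeSum G.face f = 1 := by
  have := Fintype.ofFinite E
  rw [← LinearMap.mem_range, hG.range_edgeSum_face]
  rintro _ ⟨g, rfl⟩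
  exact (dotProduct_one _).trans (sum_edgeSum_vert_eq_zero heven g)

theorem IsPlane.exists_alternating_sign [Finite V] [Finite E] (hG : G.IsPlane)
    (heven : ∀ v, Even (Nat.card {h : HalfEdge E // G.vert h = v})) :
    ∃ x : HalfEdge E → ℤˣ, (∀ h, x h.flip = -x h) ∧ ∀ h, x (G.rot h) = -x h := by
  obtain ⟨f, hf⟩ := hG.exists_edgeSum_face_eq_one heven
  let sign (a : ZMod 2) : ℤˣ := if a = 0 then 1 else -1
  have hsign : ∀ a b : ZMod 2, a + b = 1 → sign b = -sign a := by decide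
  have hflip : ∀ h, sign (f (G.face h.flip)) = -sign (f (G.face h)) := fun h =>
    hsign _ _ ((edgeSum_apply_fst G.face f h).symm.trans (congrFun hf h.1))
  refine ⟨fun h => sign (f (G.face h)), hflip, fun h => ?_⟩
  rw [← hflip, ← face_rot_flip G h.flip, HalfEdge.flip_flip]

end Faces

end EmbeddedGraph

namespace EmbeddedGraph

section UnderOver

variable {V : Type*} {E : Type*} {G : EmbeddedGraph V E}

/-- The under-over assignment that gives each thread the sign of one of its half-edges; it is used
for signs on which the two half-edges of a thread agree. -/
noncomputable def underOverOfSign (G : EmbeddedGraph V E) (x : HalfEdge E → ℤˣ) : G.UnderOver :=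
  fun p => x (Quot.out p.1).1

theorem underOverOfSign_thread {x : HalfEdge E → ℤˣ}
    (hx : ∀ a b, G.IsThread a b → x a = x b) {a b : HalfEdge E} (h : G.IsThread a b) :
    G.underOverOfSign x h.thread = x a := by
  rcases Sym2.mem_iff.1 (Sym2.out_fst_mem s(a, b)) with heq | heq
  · exact congrArg x heq
  · exact (congrArg x heq).trans (hx a b h).symm

namespace IsFourRegular

variable [Finite E]

theorem eq_of_isThread_of_rot (hG : G.IsFourRegular) {x : HalfEdge E → ℤˣ}
    (hrot : ∀ h, x (G.rot h) = -x h) (a b : HalfEdge E) (h : G.IsThread a b) : x a = x b := by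
  rw [hG.isThread_iff.1 h, hrot, hrot, neg_neg]

theorem consistent_underOverOfSign (hG : G.IsFourRegular) {x : HalfEdge E → ℤˣ}
    (hrot : ∀ h, x (G.rot h) = -x h) : (G.underOverOfSign x).Consistent := by
  intro a b a' b' h h' hv hne
  have hx := hG.eq_of_isThread_of_rot hrot
  rw [underOverOfSign_thread hx, underOverOfSign_thread hx]
  have hb := hG.isThread_iff.1 h
  have hb' := hG.isThread_iff.1 h'
  obtain ⟨i, hi, rfl⟩ := hG.exists_iterate_rot_eq hv
  interval_cases i
  · exact absurd (Subtype.ext (congrArg (s(a, ·)) (hb.trans hb'.symm))) hne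
  · exact (neg_eq_iff_eq_neg.1 (hrot a).symm)
  · exact absurd (Subtype.ext (Sym2.eq_iff.2 (.inr ⟨(hb'.trans (hG.rot_four a)).symm, hb⟩))) hne
  · change x a = -x (G.rot (G.rot (G.rot a)))
    rw [hrot, hrot, hrot, neg_neg, neg_neg]

theorem alternating_underOverOfSign (hG : G.IsFourRegular) {x : HalfEdge E → ℤˣ}
    (hflip : ∀ h, x h.flip = -x h) (hrot : ∀ h, x (G.rot h) = -x h) {P : Set G.FreeCircuit}
    (hP : G.IsThreadedCircuitPartition P) : (G.underOverOfSign x).Alternating hP := by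
  intro c hc i
  have hx := hG.eq_of_isThread_of_rot hrot
  rw [underOverOfSign_thread hx, underOverOfSign_thread hx, hflip (c.dart (i + 1)), neg_neg]
  exact hx _ _ (hP.2 c hc i)

theorem exists_consistent_alternating [Finite V] (hG : G.IsFourRegular) (hplane : G.IsPlane)
    {P : Set G.FreeCircuit} (hP : G.IsThreadedCircuitPartition P) :
    ∃ υ : G.UnderOver, υ.Consistent ∧ υ.Alternating hP := by
  obtain ⟨x, hflip, hrot⟩ := hplane.exists_alternating_sign fun v => hG v ▸ by decide
  exact ⟨G.underOverOfSign x, hG.consistent_underOverOfSign hrot,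
    hG.alternating_underOverOfSign hflip hrot hP⟩

end IsFourRegular

end UnderOver

end EmbeddedGraph

namespace EmbeddedGraph

section PartialPartitions

variable {V : Type*} {E : Type*} {G : EmbeddedGraph V E}

/-- The edges of a list of circuits, with multiplicity. -/
def edgesOf (L : List G.Circuit) : List E := L.flatMap fun c => c.darts.map Prod.fst

theorem edgesOf_concat (L : List G.Circuit) (c : G.Circuit) :
    edgesOf (L ++ [c]) = edgesOf L ++ c.darts.map Prod.fst := by
  simp only [edgesOf, List.flatMap_append, List.flatMap_singleton]

theorem length_le_length_edgesOf (L : List G.Circuit) : L.length ≤ (edgesOf L).length := by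
  induction L with
  | nil => rfl
  | cons c L ih =>
    have hc := c.length_darts_pos
    simp only [edgesOf, List.flatMap_cons, List.length_append, List.length_cons,
      List.length_map] at ih ⊢
    omega

/-- The circuits in `L` are threaded, no edge is traversed twice, and every edge in `S` is
traversed: the state of a greedy search for the threaded circuit partition. -/
structure IsPartialPartition (L : List G.Circuit) (S : Set E) : Prop where
  isThreaded : ∀ c ∈ L, c.IsThreaded
  nodup : (edgesOf L).Nodup
  subset : ∀ e ∈ S, e ∈ edgesOf L

namespace IsPartialPartition

theorem nil : IsPartialPartition ([] : List G.Circuit) ∅ :=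
  ⟨fun _ h => absurd h List.not_mem_nil, List.nodup_nil, fun _ h => h.elim⟩

variable {L : List G.Circuit} {S : Set E}

theorem insert_of_mem (hL : IsPartialPartition L S) {e : E} (he : e ∈ edgesOf L) :
    IsPartialPartition L (insert e S) :=
  ⟨hL.isThreaded, hL.nodup, Set.forall_insert_of_forall hL.subset he⟩

theorem nodup_map_free (hL : IsPartialPartition L S) : (L.map Circuit.free).Nodup := by
  rw [List.Nodup, List.pairwise_map]
  refine (List.nodup_flatMap.1 hL.nodup).2.imp fun {c c'} hdisj hfree => ?_
  obtain ⟨h, hh⟩ := List.exists_mem_of_ne_nil _ c.ne_nil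
  exact hdisj (List.mem_map_of_mem hh) ((Circuit.mem_edges_iff_of_free_eq hfree).1
    (List.mem_map_of_mem hh))

theorem length_edgesOf_le [Finite E] (hL : IsPartialPartition L S) :
    (edgesOf L).length ≤ Nat.card E := by
  have := Fintype.ofFinite E
  rw [Nat.card_eq_fintype_card]
  exact hL.nodup.length_le_card

theorem concat_circuit [Finite E] (hG : G.IsFourRegular) (hL : IsPartialPartition L S) {e : E}
    (he : e ∉ edgesOf L) :
    IsPartialPartition (L ++ [hG.circuit (e, false)]) (insert e S) := by
  have hthread := hG.isThreaded_circuit (e, false)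
  have hmem : e ∈ (hG.circuit (e, false)).darts.map Prod.fst :=
    List.mem_map.2 ⟨_, hG.mem_cycle_circuit (e, false), rfl⟩
  have hdisj : (edgesOf L).Disjoint ((hG.circuit (e, false)).darts.map Prod.fst) := by
    intro e' he' hec
    obtain ⟨c, hc, hec'⟩ := List.mem_flatMap.1 he'
    have hfree := hG.free_eq_of_common_edge (hL.isThreaded c hc) hthread hec' hec
    exact he (List.mem_flatMap.2 ⟨c, hc, (Circuit.mem_edges_iff_of_free_eq hfree).2 hmem⟩)
  constructor
  · rw [List.forall_mem_append, List.forall_mem_singleton]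
    exact ⟨hL.isThreaded, hthread⟩
  · rw [edgesOf_concat]
    exact hL.nodup.append (Circuit.edges_nodup _) hdisj
  · rw [edgesOf_concat]
    exact Set.forall_insert_of_forall (fun e' he' => List.mem_append_left _ (hL.subset e' he'))
      (List.mem_append_right _ hmem)

theorem isThreadedCircuitPartition [Finite E] (hG : G.IsFourRegular)
    (hL : IsPartialPartition L Set.univ) :
    G.IsThreadedCircuitPartition {γ | γ ∈ L.map Circuit.free} := by
  rw [hG.eq_threadedCircuits (P := {γ | γ ∈ L.map Circuit.free})]
  · exact hG.isThreadedCircuitPartition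
  · intro c hc
    obtain ⟨c', hc', hfree⟩ := List.mem_map.1 hc
    exact Circuit.isThreaded_of_free_eq hfree (hL.isThreaded c' hc')
  · intro e
    obtain ⟨c, hc, he⟩ := List.mem_flatMap.1 (hL.subset e trivial)
    exact ⟨c, List.mem_map_of_mem hc, he⟩

end IsPartialPartition

end PartialPartitions

end EmbeddedGraph

namespace RAM

namespace State

@[simp] theorem reg_setReg (s : State) (d x a : ℕ) :
    (s.setReg d x).reg a = if a = d then x else s.reg a := Function.update_apply _ _ _ _

@[simp] theorem mem_setReg (s : State) (d x : ℕ) : (s.setReg d x).mem = s.mem := rfl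

@[simp] theorem reg_setMem (s : State) (a x : ℕ) : (s.setMem a x).reg = s.reg := rfl

@[simp] theorem mem_setMem (s : State) (a x : ℕ) :
    (s.setMem a x).mem = Function.update s.mem a x := rfl

@[simp] theorem setReg_setReg (s : State) (d x y : ℕ) :
    (s.setReg d x).setReg d y = s.setReg d y := by
  simp only [setReg, Function.update_idem]

end State

/-- Programs executed one after the other. -/
def Program.block (l : List Program) : Program := l.foldr .seq .skip

/-- Total correctness with a clock: started in state `s` and computing only with numbers up to `B`,
the program halts in a state and after a number of steps that together satisfy `Q`. -/
def Halts (B : ℕ) (p : Program) (s : State) (Q : State → ℕ → Prop) : Prop :=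
  ∃ s' t, Exec B p s s' t ∧ Q s' t

variable {B d a b k : ℕ} {p q : Program} {s : State} {Q Q' : State → ℕ → Prop}

theorem Halts.mono (h : Halts B p s Q) (hQ : ∀ s' t, Q s' t → Q' s' t) : Halts B p s Q' :=
  h.imp fun s' => .imp fun t => .imp_right (hQ s' t)

@[simp] theorem halts_skip : Halts B .skip s Q ↔ Q s 1 :=
  ⟨by rintro ⟨_, _, ⟨⟩, h⟩; exact h, fun h => ⟨_, _, .skip s, h⟩⟩

@[simp] theorem halts_const : Halts B (.const d k) s Q ↔ k ≤ B ∧ Q (s.setReg d k) 1 :=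
  ⟨by rintro ⟨_, _, ⟨⟩, h⟩; exact ⟨‹_›, h⟩, fun ⟨hk, h⟩ => ⟨_, _, .const s d k hk, h⟩⟩

@[simp] theorem halts_copy : Halts B (.copy d a) s Q ↔ Q (s.setReg d (s.reg a)) 1 :=
  ⟨by rintro ⟨_, _, ⟨⟩, h⟩; exact h, fun h => ⟨_, _, .copy s d a, h⟩⟩

@[simp] theorem halts_add : Halts B (.add d a b) s Q ↔
    s.reg a + s.reg b ≤ B ∧ Q (s.setReg d (s.reg a + s.reg b)) 1 :=
  ⟨by rintro ⟨_, _, ⟨⟩, h⟩; exact ⟨‹_›, h⟩, fun ⟨hk, h⟩ => ⟨_, _, .add s d a b hk, h⟩⟩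

@[simp] theorem halts_sub : Halts B (.sub d a b) s Q ↔ Q (s.setReg d (s.reg a - s.reg b)) 1 :=
  ⟨by rintro ⟨_, _, ⟨⟩, h⟩; exact h, fun h => ⟨_, _, .sub s d a b, h⟩⟩

@[simp] theorem halts_load : Halts B (.load d a) s Q ↔ Q (s.setReg d (s.mem (s.reg a))) 1 :=
  ⟨by rintro ⟨_, _, ⟨⟩, h⟩; exact h, fun h => ⟨_, _, .load s d a, h⟩⟩

@[simp] theorem halts_store : Halts B (.store a b) s Q ↔ Q (s.setMem (s.reg a) (s.reg b)) 1 :=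
  ⟨by rintro ⟨_, _, ⟨⟩, h⟩; exact h, fun h => ⟨_, _, .store s a b, h⟩⟩

theorem halts_seq : Halts B (.seq p q) s Q ↔
    Halts B p s fun s' t => Halts B q s' fun s'' t' => Q s'' (t + t') :=
  ⟨by rintro ⟨_, _, ⟨⟩, h⟩; exact ⟨_, _, ‹_›, _, _, ‹_›, h⟩,
    fun ⟨_, _, hp, _, _, hq, h⟩ => ⟨_, _, .seq hp hq, h⟩⟩

@[simp] theorem halts_ifLt : Halts B (.ifLt a b p q) s Q ↔
    if s.reg a < s.reg b then Halts B p s fun s' t => Q s' (t + 1)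
    else Halts B q s fun s' t => Q s' (t + 1) := by
  split_ifs with hab
  · exact ⟨by rintro ⟨_, _, _ | _, h⟩ <;> first | exact ⟨_, _, ‹_›, h⟩ | contradiction,
      fun ⟨_, _, hp, h⟩ => ⟨_, _, .ifTrue q hab hp, h⟩⟩
  · exact ⟨by rintro ⟨_, _, _ | _, h⟩ <;> first | exact ⟨_, _, ‹_›, h⟩ | contradiction,
      fun ⟨_, _, hq, h⟩ => ⟨_, _, .ifFalse p hab hq, h⟩⟩

@[simp] theorem halts_block_nil : Halts B (.block []) s Q ↔ Q s 1 := halts_skip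

@[simp] theorem halts_block_cons {l : List Program} : Halts B (.block (p :: l)) s Q ↔
    Halts B p s fun s' t => Halts B (.block l) s' fun s'' t' => Q s'' (t + t') := halts_seq

/-- The first argument of the invariant is a potential that pays for the steps. -/
theorem Halts.whileLt {I : ℕ → State → Prop} (hI : I k s)
    (hbody : ∀ k s, I k s → s.reg a < s.reg b →
      Halts B p s fun s' t => ∃ k', t + 1 + k' ≤ k ∧ I k' s') :
    Halts B (.whileLt a b p) s fun s' t =>
      ∃ k', t + k' ≤ k + 1 ∧ I k' s' ∧ ¬ s'.reg a < s'.reg b := by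
  induction k using Nat.strong_induction_on generalizing s with | h k ih => ?_
  by_cases hab : s.reg a < s.reg b
  · obtain ⟨s', t, hexec, k', hk', hI'⟩ := hbody k s hI hab
    obtain ⟨s'', t', hexec', k'', hk'', hI''⟩ := ih k' (by omega) hI'
    exact ⟨s'', t + t' + 1, .whileTrue hab hexec hexec', k'', by omega, hI''⟩
  · exact ⟨s, 1, .whileFalse p hab, k, by omega, hI, hab⟩

end RAM

namespace EmbeddedGraph

open RAM

section Codes

variable {n m : ℕ}

theorem code_lt (h : HalfEdge (Fin m)) : code h < 2 * m := by
  have := h.1.2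
  unfold code
  split <;> omega

theorem code_eq_iff {h : HalfEdge (Fin m)} {e : Fin m} : code h = e ↔ h = (e, false) := by
  obtain ⟨e', _ | _⟩ := h
  · simp [code, Fin.ext_iff]
  · have := e.2
    simp only [code, if_true, Prod.mk.injEq, reduceCtorEq, and_false, iff_false]
    omega

theorem length_halfEdges : (halfEdges m).length = 2 * m := by
  simp only [halfEdges, List.length_append, List.length_map, List.length_finRange, two_mul]

theorem getElem?_halfEdges (h : HalfEdge (Fin m)) : (halfEdges m)[code h]? = some h := by
  obtain ⟨e, _ | _⟩ := h
  · simp [halfEdges, code, List.getElem?_append_left]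
  · simp [halfEdges, code]

theorem length_input (G : EmbeddedGraph (Fin n) (Fin m)) : G.input.length = 2 + 4 * m := by
  simp only [input, List.length_cons, List.length_append, List.length_map, length_halfEdges]
  ring

theorem initial_input_rot (G : EmbeddedGraph (Fin n) (Fin m)) (h : HalfEdge (Fin m)) :
    (initial G.input).mem (2 + code h) = code (G.rot h) := by
  simp only [initial, input, add_comm 2, List.getD_eq_getElem?_getD, List.getElem?_cons_succ]
  rw [List.getElem?_append_left (by simpa only [List.length_map, length_halfEdges] using code_lt h),
    List.getElem?_map, getElem?_halfEdges]
  rfl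

theorem initial_input_of_le (G : EmbeddedGraph (Fin n) (Fin m)) {a : ℕ} (ha : 2 + 4 * m ≤ a) :
    (initial G.input).mem a = 0 :=
  List.getD_eq_default _ _ (G.length_input.trans_le ha)

end Codes

/-- The entries after the first one of the output for a list of circuits. -/
def listing {n m : ℕ} {G : EmbeddedGraph (Fin n) (Fin m)} (L : List G.Circuit) : List ℕ :=
  L.flatMap fun c => c.darts.length :: c.darts.map code

section Listing

variable {n m : ℕ} {G : EmbeddedGraph (Fin n) (Fin m)}

theorem listing_concat (L : List G.Circuit) (c : G.Circuit) :
    listing (L ++ [c]) = listing L ++ (c.darts.length :: c.darts.map code) := by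
  simp only [listing, List.flatMap_append, List.flatMap_singleton]

theorem length_listing (L : List G.Circuit) :
    (listing L).length = L.length + (edgesOf L).length := by
  induction L with
  | nil => rfl
  | cons c L ih =>
    simp only [listing, edgesOf, List.flatMap_cons, List.length_append, List.length_cons,
      List.length_map] at ih ⊢
    omega

end Listing

section Program

namespace Register

/-- The register with the address `2 + 5 * m` of the output. -/
abbrev out : ℕ := 0

/-- The register with the constant `1`. -/
abbrev one : ℕ := 1

/-- The register with the constant `2`, the address of the rotation system. -/
abbrev two : ℕ := 2

/-- The register with the number `m` of edges. -/
abbrev edges : ℕ := 3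

/-- The register with the address `2 + 4 * m` of the marks of the edges. -/
abbrev marks : ℕ := 4

/-- The register with the constant `0`. -/
abbrev zero : ℕ := 5

/-- The register with the address after the output so far. -/
abbrev tail : ℕ := 6

/-- The register with the edge at which the search for a new circuit starts. -/
abbrev start : ℕ := 7

/-- The register with the number of complete circuits. -/
abbrev count : ℕ := 8

/-- The register with the half-edge that has been reached on the current circuit. -/
abbrev cur : ℕ := 9

/-- The register with a number that is `0` when the current circuit is complete. -/
abbrev gap : ℕ := 10

/-- The register with the address of the length of the current circuit. -/
abbrev head : ℕ := 11

/-- The register with an edge or its mark. -/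
abbrev edge : ℕ := 12

/-- The register for intermediate results. -/
abbrev temp : ℕ := 13

end Register

open Register

/-- Find the edge of the current half-edge, and the half-edge that follows on the circuit. -/
def nextProgram : Program := .block
  [.ifLt cur edges (.block [.copy edge cur, .add temp edges cur])
    (.block [.sub edge cur edges, .copy temp edge]),
  .add temp two temp, .load temp temp, .add temp two temp, .load temp temp]

/-- List the current half-edge, mark its edge and go to the next half-edge. -/
def stepProgram : Program := .block
  [nextProgram, .store tail cur, .add tail tail one, .add edge marks edge, .store edge one,
  .copy cur temp, .sub gap cur start, .sub temp start cur, .add gap gap temp]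

/-- Start the list of a new circuit, with `0` in the place of its length. -/
def beginProgram : Program := .block
  [.copy head tail, .store head zero, .add tail tail one, .copy cur start, .copy gap one]

/-- Store the length of a complete circuit and count the circuit. -/
def finishProgram : Program := .block
  [.sub temp tail head, .sub temp temp one, .store head temp, .add count count one]

/-- List the circuit that starts with the half-edge `(start, false)`. -/
def circuitProgram : Program := .block
  [beginProgram, .whileLt zero gap stepProgram, finishProgram]

/-- List the circuit through the edge `start` unless this edge is marked; go to the next edge. -/
def edgeProgram : Program := .block
  [.add edge marks start, .load edge edge, .ifLt edge one circuitProgram .skip,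
  .add start start one]

/-- Set up the registers. -/
def setupProgram : Program := .block
  [.const one 1, .const two 2, .load edges one,
  .add marks edges edges, .add marks marks marks, .add marks two marks,
  .add out marks edges, .add tail out one]

/-- List the circuits of the threaded circuit partition. -/
def partitionProgram : Program := .block
  [setupProgram, .whileLt start edges edgeProgram, .store out count]

end Program

section Memory

variable {n m : ℕ}

/-- The memory contains the rotation system, the marks of the edges (`1` for those in `vis`, `0`
for all others) and the numbers `out` as the entries after the first one of the output. -/
structure Stored (G : EmbeddedGraph (Fin n) (Fin m)) (vis : List (Fin m)) (out : List ℕ)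
    (mem : ℕ → ℕ) : Prop where
  rot : ∀ h, mem (2 + code h) = code (G.rot h)
  mark : ∀ e : Fin m, mem (2 + 4 * m + e) = if e ∈ vis then 1 else 0
  out : ∀ i (hi : i < out.length), mem (3 + 5 * m + i) = out[i]

namespace Stored

variable {G : EmbeddedGraph (Fin n) (Fin m)} {vis : List (Fin m)} {out : List ℕ} {mem : ℕ → ℕ}

theorem initial (G : EmbeddedGraph (Fin n) (Fin m)) : G.Stored [] [] (initial G.input).mem :=
  ⟨G.initial_input_rot, fun _ => G.initial_input_of_le (Nat.le_add_right _ _),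
    fun _ hi => absurd hi (Nat.not_lt_zero _)⟩

theorem mark_edge (hs : G.Stored vis out mem) (e : Fin m) :
    G.Stored (vis ++ [e]) out (Function.update mem (2 + 4 * m + e) 1) where
  rot h := by
    have := code_lt h
    rw [Function.update_of_ne (by omega), hs.rot]
  mark e' := by
    simp only [Function.update_apply, hs.mark, List.mem_append, List.mem_singleton,
      Nat.add_left_cancel_iff, Fin.val_inj]
    by_cases he : e' = e <;> simp [he]
  out i hi := by rw [Function.update_of_ne (by omega), hs.out i hi]

theorem update_output {out' : List ℕ} {i x : ℕ} (hs : G.Stored vis out mem)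
    (hout : ∀ j (hj : j < out'.length), out'[j] =
      if j = i then x else mem (3 + 5 * m + j)) :
    G.Stored vis out' (Function.update mem (3 + 5 * m + i) x) where
  rot h := by
    have := code_lt h
    rw [Function.update_of_ne (by omega), hs.rot]
  mark e := by rw [Function.update_of_ne (by omega), hs.mark]
  out j hj := by simp only [Function.update_apply, hout, Nat.add_left_cancel_iff]

theorem append (hs : G.Stored vis out mem) (x : ℕ) :
    G.Stored vis (out ++ [x]) (Function.update mem (3 + 5 * m + out.length) x) := by
  refine hs.update_output fun j hj => ?_
  split_ifs with h
  · simp only [h, List.getElem_concat_length]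
  · rw [List.length_append, List.length_singleton] at hj
    rw [List.getElem_append_left (by omega), hs.out]

theorem set (hs : G.Stored vis out mem) (i x : ℕ) :
    G.Stored vis (out.set i x) (Function.update mem (3 + 5 * m + i) x) := by
  refine hs.update_output fun j hj => ?_
  rw [List.getElem_set, hs.out j (by simpa only [List.length_set] using hj)]
  simp only [eq_comm]

end Stored

end Memory

end EmbeddedGraph

namespace EmbeddedGraph

open RAM Register

section Execution

attribute [local simp] out one two edges marks zero tail start count cur gap head edge temp

variable {m B : ℕ}

/-- The registers that keep their values once they have been set up. -/
structure IsSetUp (m : ℕ) (s : State) : Prop where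
  out : s.reg out = 2 + 5 * m
  one : s.reg one = 1
  two : s.reg two = 2
  edges : s.reg edges = m
  marks : s.reg marks = 2 + 4 * m
  zero : s.reg zero = 0

theorem IsSetUp.congr {s s' : State} (hs : IsSetUp m s) (h : ∀ r ≤ 5, s'.reg r = s.reg r) :
    IsSetUp m s' where
  out := (h _ (by decide)).trans hs.out
  one := (h _ (by decide)).trans hs.one
  two := (h _ (by decide)).trans hs.two
  edges := (h _ (by decide)).trans hs.edges
  marks := (h _ (by decide)).trans hs.marks
  zero := (h _ (by decide)).trans hs.zero

theorem isSetUp_setReg_iff {s : State} {d x : ℕ} (hd : 5 < d) :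
    IsSetUp m (s.setReg d x) ↔ IsSetUp m s := by
  have hreg : ∀ r ≤ 5, (s.setReg d x).reg r = s.reg r := fun r hr => by
    rw [State.reg_setReg, if_neg (by omega)]
  exact ⟨fun hs => hs.congr fun r hr => (hreg r hr).symm, fun hs => hs.congr hreg⟩

theorem isSetUp_setMem_iff {s : State} {a x : ℕ} : IsSetUp m (s.setMem a x) ↔ IsSetUp m s :=
  ⟨fun hs => hs.congr fun _ _ => rfl, fun hs => hs.congr fun _ _ => rfl⟩

variable {n : ℕ} {G : EmbeddedGraph (Fin n) (Fin m)}

/-- The part of the state that is common to the whole search: the constant registers, the memory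
and the end of the output. -/
structure Represents (G : EmbeddedGraph (Fin n) (Fin m)) (vis : List (Fin m)) (out : List ℕ)
    (s : State) : Prop where
  isSetUp : IsSetUp m s
  stored : G.Stored vis out s.mem
  tail : s.reg tail = 3 + 5 * m + out.length

/-- The circuits in `L` have been listed, and of the circuit through `e` the first `i` half-edges.
Its length is not yet known, a `0` is in its place. -/
structure IsTracing (L : List G.Circuit) (e : Fin m) (i : ℕ) (s : State) : Prop where
  represents : G.Represents (edgesOf L ++ (G.walk (e, false) i).map Prod.fst)
    (listing L ++ 0 :: (G.walk (e, false) i).map code) s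
  start : s.reg start = e
  count : s.reg count = L.length
  head : s.reg head = 3 + 5 * m + (listing L).length
  cur : s.reg cur = code (G.next^[i] (e, false))
  gap : s.reg gap = 0 ↔ i = Function.minimalPeriod G.next (e, false)

/-- The circuits in `L` have been listed, and the edges from `j` on have yet to be considered. -/
structure IsSearching (L : List G.Circuit) (j : ℕ) (s : State) : Prop where
  represents : G.Represents (edgesOf L) (listing L) s
  start : s.reg start = j
  count : s.reg count = L.length

theorem gap_eq_zero_iff {e : Fin m} {i : ℕ} (hi₀ : 0 < i)
    (hi : i ≤ Function.minimalPeriod G.next (e, false)) :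
    code (G.next^[i] (e, false)) - e + (e - code (G.next^[i] (e, false))) = 0 ↔
      i = Function.minimalPeriod G.next (e, false) := by
  rw [← iterate_eq_self_iff_eq_minimalPeriod hi₀ hi, ← code_eq_iff]
  omega

theorem halts_nextProgram (hB : 2 * m + 2 ≤ B) {s : State} {h : HalfEdge (Fin m)}
    (hedges : s.reg edges = m) (htwo : s.reg two = 2) (hcur : s.reg cur = code h)
    (hrot : ∀ h, s.mem (2 + code h) = code (G.rot h)) :
    Halts B nextProgram s fun s' t =>
      t ≤ 9 ∧ s' = (s.setReg edge h.1).setReg temp (code (G.next h)) := by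
  have hflip := code_lt h.flip
  have hflip_rot := code_lt (G.rot h.flip)
  have hload := hrot h.flip
  obtain ⟨e, _ | _⟩ := h
  · have hcur : s.reg cur = e := hcur
    have hflip_code : code (HalfEdge.flip (e, false)) = m + e := rfl
    rw [hflip_code] at hflip hload
    have hbound : m + e ≤ B ∧ 2 + (m + e) ≤ B ∧
        2 + code (G.rot (HalfEdge.flip (e, false))) ≤ B := by
      omega
    simp [nextProgram, hedges, htwo, hcur, hload, hrot, next, hbound]
  · have hcur : s.reg cur = m + e := hcur
    have hflip_code : code (HalfEdge.flip (e, true)) = e := rfl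
    rw [hflip_code] at hflip hload
    have hbound : 2 + e ≤ B ∧ 2 + code (G.rot (HalfEdge.flip (e, true))) ≤ B := by omega
    simp [nextProgram, hedges, htwo, hcur, hload, hrot, next, hbound]

theorem halts_stepProgram (hB : 10 * (m + 1) ≤ B) {L : List G.Circuit} {e : Fin m} {i : ℕ}
    {s : State} (hs : IsTracing L e i s)
    (hlen : (edgesOf L).length + Function.minimalPeriod G.next (e, false) ≤ m)
    (hi : i < Function.minimalPeriod G.next (e, false)) :
    Halts B stepProgram s fun s' t => t ≤ 18 ∧ IsTracing L e (i + 1) s' := by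
  obtain ⟨⟨hsetup, hstored, htail⟩, hstart, hcount, hhead, hcur, -⟩ := hs
  set h := G.next^[i] (e, false) with hh
  have hnext : G.next^[i + 1] (e, false) = G.next h := Function.iterate_succ_apply' _ _ _
  rw [stepProgram, halts_block_cons]
  refine (halts_nextProgram (by omega) hsetup.edges hsetup.two hcur hstored.rot).mono ?_
  rintro _ t ⟨ht, rfl⟩
  have hone := hsetup.one
  have hmarks := hsetup.marks
  have hbound : s.reg tail + 1 ≤ B := by
    have := length_le_length_edgesOf L
    simp only [htail, List.length_append, List.length_cons, List.length_map, length_walk,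
      length_listing]
    omega
  have haddr : 2 + 4 * m + h.1 ≤ B := by omega
  have hdist : code (G.next h) - e + (e - code (G.next h)) ≤ B := by
    have := code_lt (G.next h)
    omega
  have hgap := gap_eq_zero_iff i.succ_pos hi
  rw [hnext] at hgap
  have hstored' := (hstored.append (code h)).mark_edge h.1
  rw [← htail] at hstored'
  simp only [halts_block_cons, halts_block_nil, halts_copy, halts_add, halts_sub, halts_store]
  refine ⟨?_, ?_, ?_, ?_, ⟨⟨?_, ?_, ?_⟩, ?_, ?_, ?_, ?_, ?_⟩⟩
  · simp [hone, hbound]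
  · simp [hmarks, haddr]
  · simp [hstart, hdist]
  · omega
  · simp [isSetUp_setReg_iff, isSetUp_setMem_iff, hsetup]
  · simpa [walk_succ, ← hh, hcur, hmarks, hone] using hstored'
  · simp [htail, hone, walk_succ, add_assoc]
  · simp [hstart]
  · simp [hcount]
  · simp [hhead]
  · simp [hnext]
  · simpa [hstart] using hgap

theorem halts_while_stepProgram (hB : 10 * (m + 1) ≤ B) {L : List G.Circuit} {e : Fin m}
    {s : State} (hs : IsTracing L e 0 s)
    (hlen : (edgesOf L).length + Function.minimalPeriod G.next (e, false) ≤ m) :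
    Halts B (.whileLt zero gap stepProgram) s fun s' t =>
      t ≤ 20 * Function.minimalPeriod G.next (e, false) + 1 ∧
      IsTracing L e (Function.minimalPeriod G.next (e, false)) s' := by
  set p := Function.minimalPeriod G.next (e, false)
  let I : ℕ → State → Prop := fun k s => ∃ i ≤ p, k = 20 * (p - i) ∧ IsTracing L e i s
  have hgap : ∀ {i s}, IsTracing L e i s → (s.reg zero < s.reg gap ↔ i ≠ p) := fun hs => by
    rw [hs.represents.isSetUp.zero, Nat.pos_iff_ne_zero, Ne, hs.gap]
  refine (Halts.whileLt (I := I) ⟨0, Nat.zero_le _, rfl, hs⟩ ?_).mono ?_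
  · rintro k s ⟨i, hi, rfl, hs⟩ hlt
    have hi : i < p := lt_of_le_of_ne hi ((hgap hs).1 hlt)
    refine (halts_stepProgram hB hs hlen hi).mono fun s' t ⟨_, hs'⟩ => ?_
    exact ⟨_, by omega, i + 1, hi, rfl, hs'⟩
  · rintro s' t ⟨k, ht, ⟨i, -, -, hs'⟩, hend⟩
    obtain rfl : i = p := by simpa only [hgap hs', not_not] using hend
    exact ⟨by omega, hs'⟩

theorem halts_beginProgram (hB : 10 * (m + 1) ≤ B) {L : List G.Circuit} {e : Fin m} {s : State}
    (hs : IsSearching L e s) (hlen : (edgesOf L).length ≤ m) :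
    Halts B beginProgram s fun s' t => t ≤ 6 ∧ IsTracing L e 0 s' := by
  obtain ⟨⟨hsetup, hstored, htail⟩, hstart, hcount⟩ := hs
  have hone := hsetup.one
  have hzero := hsetup.zero
  have hperiod := (minimalPeriod_next_pos (G := G) (e, false)).ne
  have hbound : s.reg tail + 1 ≤ B := by
    have := length_le_length_edgesOf L
    rw [htail, length_listing]
    omega
  have hstored' := hstored.append 0
  rw [← htail] at hstored'
  simp only [beginProgram, halts_block_cons, halts_block_nil, halts_copy, halts_store, halts_add]
  refine ⟨?_, ?_, ⟨⟨?_, ?_, ?_⟩, ?_, ?_, ?_, ?_, ?_⟩⟩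
  · simp [hone, hbound]
  · omega
  · simp [isSetUp_setReg_iff, isSetUp_setMem_iff, hsetup]
  · simpa [walk, hzero] using hstored'
  · simp [htail, hone, walk, add_assoc]
  · simp [hstart]
  · simp [hcount]
  · simp [htail]
  · simp [hstart, code]
  · simpa [hone] using hperiod

theorem halts_finishProgram (hG : G.IsFourRegular) (hB : 10 * (m + 1) ≤ B) {L : List G.Circuit}
    {e : Fin m} {s : State} (hs : IsTracing L e (Function.minimalPeriod G.next (e, false)) s)
    (hlen : (edgesOf L).length ≤ m) :
    Halts B finishProgram s fun s' t =>
      t ≤ 5 ∧ IsSearching (L ++ [hG.circuit (e, false)]) e s' := by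
  obtain ⟨⟨hsetup, hstored, htail⟩, hstart, hcount, hhead, -, -⟩ := hs
  set p := Function.minimalPeriod G.next (e, false)
  have hdarts : (hG.circuit (e, false)).darts = G.walk (e, false) p := rfl
  have hone := hsetup.one
  have hbound : s.reg count + 1 ≤ B := by
    have := length_le_length_edgesOf L
    omega
  have hlength : s.reg tail - s.reg head - 1 = p := by
    simp only [htail, hhead, List.length_append, List.length_cons, List.length_map, length_walk]
    omega
  have hstored' := hstored.set (listing L).length p
  rw [← hhead, List.set_append_right _ _ le_rfl, Nat.sub_self, List.set_cons_zero] at hstored'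
  simp only [finishProgram, halts_block_cons, halts_block_nil, halts_sub, halts_store, halts_add]
  refine ⟨?_, ?_, ⟨?_, ?_, ?_⟩, ?_, ?_⟩
  · simp [hone, hbound]
  · omega
  · simp [isSetUp_setReg_iff, isSetUp_setMem_iff, hsetup]
  · simpa [listing_concat, edgesOf_concat, hdarts, length_walk, hone, hlength] using hstored'
  · simp [htail, listing_concat, hdarts]
  · simp [hstart]
  · simp [hcount, hone]

theorem halts_circuitProgram (hG : G.IsFourRegular) (hB : 10 * (m + 1) ≤ B)
    {L : List G.Circuit} {e : Fin m} {s : State} (hs : IsSearching L e s)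
    (hlen : (edgesOf (L ++ [hG.circuit (e, false)])).length ≤ m) :
    Halts B circuitProgram s fun s' t => t ≤ 20 * (hG.circuit (e, false)).darts.length + 13 ∧
      IsSearching (L ++ [hG.circuit (e, false)]) e s' := by
  have hdarts : (hG.circuit (e, false)).darts.length = Function.minimalPeriod G.next (e, false) :=
    length_walk _ _
  rw [edgesOf_concat, List.length_append, List.length_map, hdarts] at hlen
  rw [hdarts]
  simp only [circuitProgram, halts_block_cons, halts_block_nil]
  refine (halts_beginProgram hB hs (by omega)).mono fun s₁ t₁ ⟨_, hs₁⟩ => ?_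
  refine (halts_while_stepProgram hB hs₁ hlen).mono fun s₂ t₂ ⟨_, hs₂⟩ => ?_
  exact (halts_finishProgram hG hB hs₂ (by omega)).mono fun s₃ t₃ ⟨_, hs₃⟩ => ⟨by omega, hs₃⟩

theorem IsSearching.setReg {L : List G.Circuit} {j d x : ℕ} {s : State}
    (hs : IsSearching L j s) (hd : 8 < d) : IsSearching L j (s.setReg d x) := by
  obtain ⟨⟨hsetup, hstored, htail⟩, hstart, hcount⟩ := hs
  have hreg : ∀ r ≤ 8, (s.setReg d x).reg r = s.reg r := fun r hr => by
    rw [State.reg_setReg, if_neg (by omega)]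
  exact ⟨⟨(isSetUp_setReg_iff (by omega)).2 hsetup, hstored, (hreg _ (by decide)).trans htail⟩,
    (hreg _ (by decide)).trans hstart, (hreg _ (by decide)).trans hcount⟩

theorem IsSearching.setReg_start {L : List G.Circuit} {j : ℕ} {s : State}
    (hs : IsSearching L j s) (i : ℕ) : IsSearching L i (s.setReg Register.start i) :=
  ⟨⟨(isSetUp_setReg_iff (by decide)).2 hs.represents.isSetUp, hs.represents.stored,
    hs.represents.tail⟩, rfl, hs.count⟩

theorem halts_edgeProgram (hG : G.IsFourRegular) (hB : 10 * (m + 1) ≤ B)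
    {L : List G.Circuit} {S : Set (Fin m)} (hL : IsPartialPartition L S) {e : Fin m} {s : State}
    (hs : IsSearching L e s) :
    Halts B edgeProgram s fun s' t => ∃ L' : List G.Circuit,
      IsPartialPartition L' (insert e S) ∧ IsSearching L' (e + 1) s' ∧
      t + 20 * (edgesOf L).length ≤ 20 * (edgesOf L').length + 18 := by
  have hsetup := hs.represents.isSetUp
  have hmark := hs.represents.stored.mark e
  have hbound : 2 + 4 * m + (e : ℕ) ≤ B ∧ (e : ℕ) + 1 ≤ B := by omega
  have hload (x : ℕ) : IsSearching L e (s.setReg edge x) := hs.setReg (by decide)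
  have hsearch : Halts B (.ifLt edge one circuitProgram .skip)
      (s.setReg edge (s.mem (2 + 4 * m + e))) fun s' t => ∃ L' : List G.Circuit,
        IsPartialPartition L' (insert e S) ∧ IsSearching L' e s' ∧
        t + 20 * (edgesOf L).length ≤ 20 * (edgesOf L').length + 14 := by
    rw [halts_ifLt, State.reg_setReg, if_pos rfl, (hload _).represents.isSetUp.one, hmark]
    by_cases he : e ∈ edgesOf L
    · rw [if_pos he, if_neg (lt_irrefl 1), halts_skip]
      exact ⟨L, hL.insert_of_mem he, hload _, by omega⟩
    · rw [if_neg he, if_pos one_pos]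
      have hL' := hL.concat_circuit hG he
      have hlen := hL'.length_edgesOf_le
      rw [Nat.card_fin] at hlen
      refine (halts_circuitProgram hG hB (hload _) hlen).mono fun s' t ⟨_, hs'⟩ => ?_
      refine ⟨_, hL', hs', ?_⟩
      rw [edgesOf_concat, List.length_append, List.length_map]
      omega
  have hadvance {L' : List G.Circuit} {s' : State} (hs' : IsSearching L' e s') :
      Halts B (.add start start one) s' fun s'' t => t = 1 ∧ IsSearching L' (e + 1) s'' := by
    rw [halts_add, hs'.start, hs'.represents.isSetUp.one]
    exact ⟨hbound.2, rfl, hs'.setReg_start _⟩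
  simp only [edgeProgram, halts_block_cons, halts_block_nil]
  refine halts_add.2 ⟨by simp only [hsetup.marks, hs.start, hbound], halts_load.2 ?_⟩
  rw [State.setReg_setReg, State.reg_setReg, if_pos rfl, State.mem_setReg, hsetup.marks, hs.start]
  exact hsearch.mono fun s' t ⟨L', hL', hs', ht⟩ =>
    (hadvance hs').mono fun s'' t' ⟨_, hs''⟩ => ⟨L', hL', hs'', by omega⟩

theorem halts_while_edgeProgram (hG : G.IsFourRegular) (hB : 10 * (m + 1) ≤ B) {s : State}
    (hs : IsSearching (G := G) [] 0 s) :
    Halts B (.whileLt start edges edgeProgram) s fun s' t => t ≤ 40 * m + 1 ∧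
      ∃ L : List G.Circuit, IsPartialPartition L Set.univ ∧ IsSearching L m s' := by
  let I : ℕ → State → Prop := fun k s => ∃ (L : List G.Circuit) (j : ℕ), j ≤ m ∧
    k = 20 * (m - j) + 20 * (m - (edgesOf L).length) ∧
    IsPartialPartition L {e | (e : ℕ) < j} ∧ IsSearching L j s
  have hempty : {e : Fin m | (e : ℕ) < 0} = ∅ := by simp
  have huniv : {e : Fin m | (e : ℕ) < m} = Set.univ := by simp
  have hinit : I (40 * m) s :=
    ⟨[], 0, Nat.zero_le m, by simp only [edgesOf, List.flatMap_nil, List.length_nil]; omega,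
      hempty ▸ .nil, hs⟩
  refine (Halts.whileLt hinit ?_).mono ?_
  · rintro k s ⟨L, j, -, rfl, hL, hs⟩ hlt
    rw [hs.start, hs.represents.isSetUp.edges] at hlt
    refine (halts_edgeProgram hG hB hL (e := ⟨j, hlt⟩) hs).mono ?_
    rintro s' t ⟨L', hL', hs', ht⟩
    have hinsert : insert ⟨j, hlt⟩ {e : Fin m | (e : ℕ) < j} =
        {e : Fin m | (e : ℕ) < j + 1} := by
      ext e
      simp only [Set.mem_insert_iff, Fin.ext_iff, Set.mem_ofPred_eq]
      omega
    have hlen := hL'.length_edgesOf_le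
    rw [Nat.card_fin] at hlen
    exact ⟨_, by omega, L', j + 1, hlt, rfl, hinsert ▸ hL', hs'⟩
  · rintro s' t ⟨k, ht, ⟨L, j, hj, -, hL, hs'⟩, hend⟩
    rw [hs'.start, hs'.represents.isSetUp.edges, not_lt] at hend
    obtain rfl := hj.antisymm hend
    exact ⟨by omega, L, huniv ▸ hL, hs'⟩

theorem halts_setupProgram (G : EmbeddedGraph (Fin n) (Fin m)) (hB : 10 * (m + 1) ≤ B) :
    Halts B setupProgram (initial G.input) fun s t => t ≤ 9 ∧ IsSearching (G := G) [] 0 s := by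
  have hedges : (initial G.input).mem 1 = m := rfl
  have hzero (r : ℕ) : (initial G.input).reg r = 0 := rfl
  have hmarks : 2 + (m + m + (m + m)) = 2 + 4 * m := by omega
  have hout : 2 + 4 * m + m = 2 + 5 * m := by omega
  have htail : 2 + 5 * m + 1 = 3 + 5 * m := by omega
  simp only [setupProgram, halts_block_cons, halts_block_nil, halts_const, halts_add, halts_load,
    State.reg_setReg, State.mem_setReg, one, two, edges, marks, out, tail, Nat.reduceEqDiff,
    if_true, if_false, hedges, hmarks, hout, htail]
  refine ⟨by omega, by omega, by omega, by omega, by omega, by omega, by omega, by omega,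
    ⟨⟨?_, ?_, ?_, ?_, ?_, ?_⟩, .initial G, ?_⟩, ?_, ?_⟩ <;>
    simp [hzero, listing]

theorem halts_partitionProgram (hG : G.IsFourRegular) (hB : 10 * (m + 1) ≤ B) :
    Halts B partitionProgram (initial G.input) fun s t => t ≤ 40 * m + 13 ∧
      ∃ L : List G.Circuit, IsPartialPartition L Set.univ ∧ Presents s (output L) := by
  simp only [partitionProgram, halts_block_cons, halts_block_nil]
  refine (halts_setupProgram G hB).mono fun s₁ t₁ ⟨_, hs₁⟩ => ?_
  refine (halts_while_edgeProgram hG hB hs₁).mono fun s₂ t₂ ⟨_, L, hL, hs₂⟩ => ?_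
  refine halts_store.2 ⟨by omega, L, hL, ?_⟩
  have hout : s₂.reg 0 = 2 + 5 * m := hs₂.represents.isSetUp.out
  rintro ⟨_ | i, hi⟩
  · rw [State.mem_setMem, State.reg_setMem, Nat.add_zero, Function.update_self, hs₂.count]
    rfl
  · have hi : i < (listing L).length := Nat.lt_of_succ_lt_succ hi
    have haddr : s₂.reg 0 + (i + 1) = 3 + 5 * m + i := by omega
    change Function.update s₂.mem (s₂.reg 0) (s₂.reg count) (s₂.reg 0 + (i + 1)) = (listing L)[i]
    rw [Function.update_of_ne (by omega), haddr, hs₂.represents.stored.out]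

end Execution

end EmbeddedGraph

namespace EmbeddedGraph

/-- The program lists the circuits of a threaded circuit partition of `G`, each of them once, in
at most `N` steps and using only numbers up to `N`. -/
def ListsThreadedCircuitPartition {n m : ℕ} (G : EmbeddedGraph (Fin n) (Fin m)) (p : RAM.Program)
    (N : ℕ) : Prop :=
  ∃ (s : RAM.State) (t : ℕ) (L : List G.Circuit),
    RAM.Exec N p (RAM.initial G.input) s t ∧ t ≤ N ∧ RAM.Presents s (output L) ∧
    (L.map Circuit.free).Nodup ∧ G.IsThreadedCircuitPartition {γ | γ ∈ L.map Circuit.free}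

theorem IsFourRegular.listsThreadedCircuitPartition {n m : ℕ}
    {G : EmbeddedGraph (Fin n) (Fin m)} (hG : G.IsFourRegular) :
    G.ListsThreadedCircuitPartition partitionProgram (40 * (n + m + 1)) := by
  obtain ⟨s, t, hexec, ht, L, hL, hout⟩ :=
    halts_partitionProgram hG (B := 40 * (n + m + 1)) (by omega)
  exact ⟨s, t, L, hexec, by omega, hout, hL.nodup_map_free, hL.isThreadedCircuitPartition hG⟩

end EmbeddedGraph

theorem theorem1_general :
    (∀ (V : Type u) (E : Type v) [Finite V] [Finite E] (G : EmbeddedGraph V E),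
      G.IsFourRegular →
        (∃! P : Set G.FreeCircuit, G.IsThreadedCircuitPartition P) ∧
        (G.IsPlane → ∀ (P : Set G.FreeCircuit) (hP : G.IsThreadedCircuitPartition P),
          ∃ υ : G.UnderOver, υ.Consistent ∧ υ.Alternating hP)) ∧
    ∃ (p : RAM.Program) (C : ℕ), ∀ (n m : ℕ) (G : EmbeddedGraph (Fin n) (Fin m)),
      G.IsFourRegular → G.ListsThreadedCircuitPartition p (C * (n + m + 1)) := by
  refine ⟨fun V E _ _ G hG => ⟨?_, fun hplane P hP => ?_⟩, EmbeddedGraph.partitionProgram, 40,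
    fun n m G hG => hG.listsThreadedCircuitPartition⟩
  · exact hG.existsUnique_isThreadedCircuitPartition
  · exact hG.exists_consistent_alternating hplane hP

theorem theorem1 :
    (∀ (V : Type u) (E : Type v) [Finite V] [Finite E] (G : EmbeddedGraph V E),
      G.IsPlane → G.IsFourRegular →
        (∃! P : Set G.FreeCircuit, G.IsThreadedCircuitPartition P) ∧
        ∀ (P : Set G.FreeCircuit) (hP : G.IsThreadedCircuitPartition P),
          ∃ υ : G.UnderOver, υ.Consistent ∧ υ.Alternating hP) ∧
    ∃ p : RAM.Program, EmbeddedGraph.FindsThreadedCircuitPartitionInLinearTime p :=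
  ⟨fun V E _ _ G hplane hG => (theorem1_general.1 V E G hG).imp_right fun h => h hplane,
    theorem1_general.{u, v}.2.imp fun _ ⟨C, hC⟩ => ⟨C, fun n m G _ hG => hC n m G hG⟩⟩
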